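/- Let $H^k(I)$ denote the usual complex Sobolev spaces on an open interval $I$, with point values taken for the continuous representatives. Let $$X=\{(u,v,w)\in H^1(-1,0)\times L^2(-1,0)\times L^2(0,\infty): u(-1)=0\}$$ be the Hilbert space with norm $\|(u,v,w)\|_X^2=\|u'\|_{L^2(-1,0)}^2+\|v\|_{L^2(-1,0)}^2+\|w\|_{L^2(0,\infty)}^2$. Let $A$ be the wave–heat operator on $X$ defined by $A(u,v,w)=(v,u'',w'')$ on the domain $$D(A)=\{(u,v,w)\in H^2(-1,0)\times H^1(-1,0)\times H^2(0,\infty): u(-1)=v(-1)=0,\ u'(0)=w'(0),\ v(0)=w(0)\}.$$ For $\lambda$ in the resolvent set $\rho(A)$, that is, when $\lambda-A\colon D(A)\to X$ is bijective with bounded inverse, write $R(\lambda,A)=(\lambda-A)^{-1}$. Then $is\in\rho(A)$ for every $s\in\mathbb{R}\setminus\{0\}$, and the operator norm of the resolvent on $X$ satisfies (a) $\|R(is,A)\|=O(|s|^{1/2})$ as $|s|\to\infty$; (b) $\|R(is,A)\|=O(|s|^{-1})$ as $|s|\to0$. -/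

import Mathlib

open MeasureTheory Set Filter Topology
open scoped ContDiff Asymptotics

noncomputable section

namespace WaveHeat

/-! ### Sobolev spaces of order one and two on an open subset of the line -/

/-- Complex-valued `L²(Ω)`. -/
abbrev L2 (Ω : TopologicalSpace.Opens ℝ) : Type :=
  Lp ℂ 2 (volume.restrict (Ω : Set ℝ))

/-- `g ∈ L²(Ω)` is the weak derivative of `u ∈ L²(Ω)`:
`∫ φ' u = - ∫ φ g` for every test function `φ ∈ C_c^∞(Ω)`. -/
def IsWeakDeriv {Ω : TopologicalSpace.Opens ℝ} (u g : L2 Ω) : Prop :=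
  ∀ φ : ℝ → ℝ, ContDiff ℝ ∞ φ → HasCompactSupport φ → tsupport φ ⊆ (Ω : Set ℝ) →
    ∫ x in (Ω : Set ℝ), deriv φ x • u x = - ∫ x in (Ω : Set ℝ), φ x • g x

section WeakDeriv

variable {Ω : TopologicalSpace.Opens ℝ}

theorem integrable_smul_of_test (u : L2 Ω) {φ : ℝ → ℝ} (hc : Continuous φ)
    (hs : HasCompactSupport φ) :
    Integrable (fun x => φ x • u x) (volume.restrict (Ω : Set ℝ)) := by
  have h1 : MemLp φ 2 (volume.restrict (Ω : Set ℝ)) := hc.memLp_of_hasCompactSupport hs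
  exact memLp_one_iff_integrable.1 ((Lp.memLp u).smul h1)

theorem IsWeakDeriv.add {u₁ u₂ g₁ g₂ : L2 Ω} (h₁ : IsWeakDeriv u₁ g₁)
    (h₂ : IsWeakDeriv u₂ g₂) : IsWeakDeriv (u₁ + u₂) (g₁ + g₂) := by
  intro φ hφ hs ht
  have hd : Continuous (deriv φ) := hφ.continuous_deriv (by simp)
  have e₁ : ∫ x in (Ω : Set ℝ), deriv φ x • (u₁ + u₂ : L2 Ω) x
      = ∫ x in (Ω : Set ℝ), (deriv φ x • u₁ x + deriv φ x • u₂ x) := by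
    refine integral_congr_ae ?_
    filter_upwards [Lp.coeFn_add u₁ u₂] with x hx
    rw [hx, Pi.add_apply, smul_add]
  have e₂ : ∫ x in (Ω : Set ℝ), φ x • (g₁ + g₂ : L2 Ω) x
      = ∫ x in (Ω : Set ℝ), (φ x • g₁ x + φ x • g₂ x) := by
    refine integral_congr_ae ?_
    filter_upwards [Lp.coeFn_add g₁ g₂] with x hx
    rw [hx, Pi.add_apply, smul_add]
  rw [e₁, e₂, integral_add (integrable_smul_of_test u₁ hd hs.deriv)
      (integrable_smul_of_test u₂ hd hs.deriv),
    integral_add (integrable_smul_of_test g₁ hφ.continuous hs)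
      (integrable_smul_of_test g₂ hφ.continuous hs), h₁ φ hφ hs ht, h₂ φ hφ hs ht, neg_add]

theorem IsWeakDeriv.smul {u g : L2 Ω} (c : ℂ) (h : IsWeakDeriv u g) :
    IsWeakDeriv (c • u) (c • g) := by
  intro φ hφ hs ht
  have e₁ : ∫ x in (Ω : Set ℝ), deriv φ x • (c • u : L2 Ω) x
      = ∫ x in (Ω : Set ℝ), c • (deriv φ x • u x) := by
    refine integral_congr_ae ?_
    filter_upwards [Lp.coeFn_smul c u] with x hx
    rw [hx, Pi.smul_apply, smul_comm]
  have e₂ : ∫ x in (Ω : Set ℝ), φ x • (c • g : L2 Ω) x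
      = ∫ x in (Ω : Set ℝ), c • (φ x • g x) := by
    refine integral_congr_ae ?_
    filter_upwards [Lp.coeFn_smul c g] with x hx
    rw [hx, Pi.smul_apply, smul_comm]
  rw [e₁, e₂, integral_smul, integral_smul, h φ hφ hs ht, smul_neg]

theorem IsWeakDeriv.zero : IsWeakDeriv (0 : L2 Ω) 0 := by
  intro φ hφ hs ht
  have e (ψ : ℝ → ℝ) : ∫ x in (Ω : Set ℝ), ψ x • (0 : L2 Ω) x = 0 := by
    rw [integral_eq_zero_of_ae]
    filter_upwards [Lp.coeFn_zero ℂ 2 (volume.restrict (Ω : Set ℝ))] with x hx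
    rw [hx]
    exact smul_zero _
  rw [e, e, neg_zero]

/-- Fundamental lemma of the calculus of variations in `L²(Ω)`. -/
theorem ae_eq_zero_of_test (f : ℝ → ℂ) (hf : LocallyIntegrableOn f (Ω : Set ℝ))
    (h : ∀ φ : ℝ → ℝ, ContDiff ℝ ∞ φ → HasCompactSupport φ → tsupport φ ⊆ (Ω : Set ℝ) →
      ∫ x in (Ω : Set ℝ), φ x • f x = 0) :
    f =ᵐ[volume.restrict (Ω : Set ℝ)] 0 := by
  have h2 := Ω.isOpen.ae_eq_zero_of_integral_contDiff_smul_eq_zero hf (by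
    intro φ h1 h2 h3
    rw [← h φ h1 h2 h3]
    symm
    apply setIntegral_eq_integral_of_forall_compl_eq_zero
    intro x hx
    have : φ x = 0 := by
      by_contra h0
      exact hx (h3 (subset_tsupport _ h0))
    simp [this])
  exact (ae_restrict_iff' Ω.isOpen.measurableSet).2 h2

theorem locallyIntegrableOn_L2 (u : L2 Ω) : LocallyIntegrableOn u (Ω : Set ℝ) := by
  have h : LocallyIntegrable u (volume.restrict (Ω : Set ℝ)) :=
    (Lp.memLp u).locallyIntegrable (by norm_num)
  exact locallyIntegrableOn_of_locallyIntegrable_restrict h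

theorem IsWeakDeriv.unique {u g₁ g₂ : L2 Ω} (h₁ : IsWeakDeriv u g₁)
    (h₂ : IsWeakDeriv u g₂) : g₁ = g₂ := by
  have key : ((g₁ - g₂ : L2 Ω) : ℝ → ℂ) =ᵐ[volume.restrict (Ω : Set ℝ)] 0 := by
    refine ae_eq_zero_of_test _ (locallyIntegrableOn_L2 _) ?_
    intro φ hφ hs ht
    have h := (h₁.add (h₂.smul (-1))) φ hφ hs ht
    have e₀ : u + (-1 : ℂ) • u = 0 := by simp
    have e₁ : g₁ + (-1 : ℂ) • g₂ = g₁ - g₂ := by simp [sub_eq_add_neg]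
    rw [e₀, e₁] at h
    have e : ∫ x in (Ω : Set ℝ), deriv φ x • (0 : L2 Ω) x = 0 := by
      rw [integral_eq_zero_of_ae]
      filter_upwards [Lp.coeFn_zero ℂ 2 (volume.restrict (Ω : Set ℝ))] with x hx
      rw [hx]
      exact smul_zero _
    rw [e] at h
    exact neg_eq_zero.1 h.symm
  exact sub_eq_zero.1 ((Lp.eq_zero_iff_ae_eq_zero).2 key)

end WeakDeriv

/-- The Sobolev space `H¹(Ω)`. -/
def sobolevH1 (Ω : TopologicalSpace.Opens ℝ) : Submodule ℂ (L2 Ω) where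
  carrier := {u | ∃ g : L2 Ω, IsWeakDeriv u g}
  add_mem' := by
    rintro u v ⟨g, hg⟩ ⟨k, hk⟩
    exact ⟨g + k, hg.add hk⟩
  zero_mem' := ⟨0, IsWeakDeriv.zero⟩
  smul_mem' := by
    rintro c u ⟨g, hg⟩
    exact ⟨c • g, hg.smul c⟩

open Classical in
/-- The weak derivative `u'` of `u ∈ H¹(Ω)` (and `0` if `u ∉ H¹(Ω)`). -/
def weakDeriv {Ω : TopologicalSpace.Opens ℝ} (u : L2 Ω) : L2 Ω :=
  if h : ∃ g : L2 Ω, IsWeakDeriv u g then h.choose else 0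

section WeakDeriv

variable {Ω : TopologicalSpace.Opens ℝ}

theorem isWeakDeriv_weakDeriv {u : L2 Ω} (hu : u ∈ sobolevH1 Ω) :
    IsWeakDeriv u (weakDeriv u) := by
  have h : ∃ g : L2 Ω, IsWeakDeriv u g := hu
  rw [weakDeriv, dif_pos h]
  exact h.choose_spec

theorem weakDeriv_add {u v : L2 Ω} (hu : u ∈ sobolevH1 Ω) (hv : v ∈ sobolevH1 Ω) :
    weakDeriv (u + v) = weakDeriv u + weakDeriv v :=
  (isWeakDeriv_weakDeriv (add_mem hu hv)).unique
    ((isWeakDeriv_weakDeriv hu).add (isWeakDeriv_weakDeriv hv))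

theorem weakDeriv_smul {u : L2 Ω} (c : ℂ) (hu : u ∈ sobolevH1 Ω) :
    weakDeriv (c • u) = c • weakDeriv u :=
  (isWeakDeriv_weakDeriv ((sobolevH1 Ω).smul_mem c hu)).unique
    ((isWeakDeriv_weakDeriv hu).smul c)

theorem weakDeriv_zero : weakDeriv (0 : L2 Ω) = 0 :=
  (isWeakDeriv_weakDeriv (sobolevH1 Ω).zero_mem).unique IsWeakDeriv.zero

end WeakDeriv

/-- The Sobolev space `H²(Ω)`: those `u ∈ H¹(Ω)` with `u' ∈ H¹(Ω)`. -/
def sobolevH2 (Ω : TopologicalSpace.Opens ℝ) : Submodule ℂ (L2 Ω) where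
  carrier := {u | u ∈ sobolevH1 Ω ∧ weakDeriv u ∈ sobolevH1 Ω}
  add_mem' := by
    rintro u v ⟨hu, hu'⟩ ⟨hv, hv'⟩
    refine ⟨add_mem hu hv, ?_⟩
    rw [weakDeriv_add hu hv]
    exact add_mem hu' hv'
  zero_mem' := ⟨zero_mem _, by rw [weakDeriv_zero]; exact zero_mem _⟩
  smul_mem' := by
    rintro c u ⟨hu, hu'⟩
    refine ⟨Submodule.smul_mem _ c hu, ?_⟩
    rw [weakDeriv_smul c hu]
    exact Submodule.smul_mem _ c hu'

/-- `u(a) = c` for a point `a` of `closure Ω`, in the sense of the continuous representative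
of `u` on `closure Ω`. -/
def HasBoundaryValue {Ω : TopologicalSpace.Opens ℝ} (u : L2 Ω) (a : ℝ) (c : ℂ) : Prop :=
  ∃ U : ℝ → ℂ, ContinuousOn U (closure (Ω : Set ℝ)) ∧
    u =ᵐ[volume.restrict (Ω : Set ℝ)] U ∧ U a = c

section BoundaryValue

variable {Ω : TopologicalSpace.Opens ℝ}

theorem HasBoundaryValue.add {u v : L2 Ω} {a : ℝ} {c d : ℂ} (hu : HasBoundaryValue u a c)
    (hv : HasBoundaryValue v a d) : HasBoundaryValue (u + v) a (c + d) := by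
  obtain ⟨U, hU, hUe, rfl⟩ := hu
  obtain ⟨V, hV, hVe, rfl⟩ := hv
  refine ⟨U + V, hU.add hV, ?_, rfl⟩
  filter_upwards [Lp.coeFn_add u v, hUe, hVe] with x h1 h2 h3
  rw [h1, Pi.add_apply, Pi.add_apply, h2, h3]

theorem HasBoundaryValue.smul {u : L2 Ω} {a : ℝ} {c : ℂ} (k : ℂ)
    (hu : HasBoundaryValue u a c) : HasBoundaryValue (k • u) a (k * c) := by
  obtain ⟨U, hU, hUe, rfl⟩ := hu
  refine ⟨k • U, hU.const_smul k, ?_, rfl⟩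
  filter_upwards [Lp.coeFn_smul k u, hUe] with x h1 h2
  rw [h1, Pi.smul_apply, Pi.smul_apply, h2]

theorem HasBoundaryValue.zero (a : ℝ) : HasBoundaryValue (0 : L2 Ω) a 0 :=
  ⟨0, continuousOn_const, Lp.coeFn_zero _ _ _, rfl⟩

end BoundaryValue

/-! ### The state space -/

/-- The interval `(-1, 0)` carrying the wave part. -/
def waveInterval : TopologicalSpace.Opens ℝ := ⟨Ioo (-1) 0, isOpen_Ioo⟩

/-- The half-line `(0, ∞)` carrying the heat part. -/
def heatInterval : TopologicalSpace.Opens ℝ := ⟨Ioi 0, isOpen_Ioi⟩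

/-- `{(u, v, w) ∈ H¹(-1,0) × L²(-1,0) × L²(0,∞) : u(-1) = 0}` as a space of triples. -/
def stateSubmodule : Submodule ℂ (L2 waveInterval × L2 waveInterval × L2 heatInterval) where
  carrier := {x | x.1 ∈ sobolevH1 waveInterval ∧ HasBoundaryValue x.1 (-1) 0}
  add_mem' := by
    rintro x y ⟨hx, hx'⟩ ⟨hy, hy'⟩
    exact ⟨add_mem hx hy, by simpa using hx'.add hy'⟩
  zero_mem' := ⟨zero_mem _, HasBoundaryValue.zero _⟩
  smul_mem' := by
    rintro c x ⟨hx, hx'⟩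
    exact ⟨Submodule.smul_mem _ c hx, by simpa using hx'.smul c⟩

/-- The state space `X`. It is a type of its own so that it does not inherit the norm of the
ambient product. -/
def StateSpace : Type := stateSubmodule

instance : AddCommGroup StateSpace := inferInstanceAs (AddCommGroup stateSubmodule)

instance : Module ℂ StateSpace := inferInstanceAs (Module ℂ stateSubmodule)

namespace StateSpace

/-- The displacement component `u` of a state `(u, v, w)`. -/
def u (x : StateSpace) : L2 waveInterval := x.val.1

/-- The velocity component `v` of a state `(u, v, w)`. -/
def v (x : StateSpace) : L2 waveInterval := x.val.2.1

/-- The heat component `w` of a state `(u, v, w)`. -/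
def w (x : StateSpace) : L2 heatInterval := x.val.2.2

/-- The state `(u, v, w)`. -/
def mk (u v : L2 waveInterval) (w : L2 heatInterval) (hu : u ∈ sobolevH1 waveInterval)
    (hb : HasBoundaryValue u (-1) 0) : StateSpace := ⟨(u, v, w), hu, hb⟩

theorem u_mem (x : StateSpace) : x.u ∈ sobolevH1 waveInterval := x.property.1

theorem u_left (x : StateSpace) : HasBoundaryValue x.u (-1) 0 := x.property.2

@[simp] theorem u_add (x y : StateSpace) : (x + y).u = x.u + y.u := rfl
@[simp] theorem v_add (x y : StateSpace) : (x + y).v = x.v + y.v := rfl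
@[simp] theorem w_add (x y : StateSpace) : (x + y).w = x.w + y.w := rfl
@[simp] theorem u_smul (c : ℂ) (x : StateSpace) : (c • x).u = c • x.u := rfl
@[simp] theorem v_smul (c : ℂ) (x : StateSpace) : (c • x).v = c • x.v := rfl
@[simp] theorem w_smul (c : ℂ) (x : StateSpace) : (c • x).w = c • x.w := rfl
@[simp] theorem u_zero : (0 : StateSpace).u = 0 := rfl
@[simp] theorem v_zero : (0 : StateSpace).v = 0 := rfl
@[simp] theorem w_zero : (0 : StateSpace).w = 0 := rfl

theorem ext {x y : StateSpace} (hu : x.u = y.u) (hv : x.v = y.v) (hw : x.w = y.w) : x = y :=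
  Subtype.ext (Prod.ext hu (Prod.ext hv hw))

/-- The linear map `(u, v, w) ↦ (u', v, w)` into the Hilbert sum
`L²(-1,0) ⊕ L²(-1,0) ⊕ L²(0,∞)`, from which `X` takes its inner product and norm. -/
def energyMap : StateSpace →ₗ[ℂ]
    WithLp 2 (L2 waveInterval × WithLp 2 (L2 waveInterval × L2 heatInterval)) where
  toFun x := WithLp.toLp 2 (weakDeriv x.u, WithLp.toLp 2 (x.v, x.w))
  map_add' x y := by
    rw [u_add, weakDeriv_add x.u_mem y.u_mem]
    rfl
  map_smul' c x := by
    rw [u_smul, weakDeriv_smul c x.u_mem]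
    rfl

end StateSpace

/-- A function in `L²(-1,0)` with zero weak derivative is constant. -/
theorem ae_eq_const_of_isWeakDeriv_zero {u : L2 waveInterval} (h : IsWeakDeriv u 0) :
    ∃ c : ℂ, u =ᵐ[volume.restrict (Ioo (-1 : ℝ) 0)] fun _ => c := by
  let b : ContDiffBump (-1 / 2 : ℝ) := ⟨1 / 8, 1 / 4, by norm_num, by norm_num⟩
  let ψ : ℝ → ℝ := b.normed volume
  have hψ1 : ContDiff ℝ ∞ ψ := b.contDiff_normed
  have hψ2 : HasCompactSupport ψ := b.hasCompactSupport_normed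
  have hψ3 : tsupport ψ ⊆ Ioo (-1 : ℝ) 0 := by
    rw [b.tsupport_normed_eq, Real.closedBall_eq_Icc]
    intro x hx
    have h1 : (-1 / 2 : ℝ) - 1 / 4 ≤ x := hx.1
    have h2 : x ≤ (-1 / 2 : ℝ) + 1 / 4 := hx.2
    constructor <;> linarith
  have hψ4 : ∫ x, ψ x = 1 := b.integral_normed
  refine ⟨∫ x in Ioo (-1 : ℝ) 0, ψ x • u x, ?_⟩
  set c : ℂ := ∫ x in Ioo (-1 : ℝ) 0, ψ x • u x with hc
  -- a test function of vanishing integral is the derivative of a test function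
  have key : ∀ ζ : ℝ → ℝ, ContDiff ℝ ∞ ζ → HasCompactSupport ζ → tsupport ζ ⊆ Ioo (-1 : ℝ) 0 →
      ∫ x, ζ x = 0 → ∫ x in Ioo (-1 : ℝ) 0, ζ x • u x = 0 := by
    intro ζ h1 h2 h3 h4
    have hK : IsCompact (insert (-1 / 2 : ℝ) (tsupport ζ)) := h2.isCompact.insert _
    have hKs : insert (-1 / 2 : ℝ) (tsupport ζ) ⊆ Ioo (-1 : ℝ) 0 :=
      insert_subset (by constructor <;> norm_num) h3
    obtain ⟨p, hp, hp'⟩ := hK.exists_isLeast (insert_nonempty _ _)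
    obtain ⟨q, hq, hq'⟩ := hK.exists_isGreatest (insert_nonempty _ _)
    have hp0 := hKs hp
    have hq0 := hKs hq
    have hz : ∀ x, x < p ∨ q < x → ζ x = 0 := by
      intro x hx
      by_contra h0
      have hm : x ∈ insert (-1 / 2 : ℝ) (tsupport ζ) := mem_insert_of_mem _ (subset_tsupport _ h0)
      rcases hx with hx | hx
      · exact absurd (hp' hm) (not_le.2 hx)
      · exact absurd (hq' hm) (not_le.2 hx)
    have hcont : Continuous ζ := h1.continuous
    let φ : ℝ → ℝ := fun x => ∫ t in (-1 : ℝ)..x, ζ t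
    have hd : ∀ x, HasDerivAt φ (ζ x) x := fun x =>
      intervalIntegral.integral_hasDerivAt_right (hcont.intervalIntegrable _ _)
        (hcont.stronglyMeasurableAtFilter _ _) hcont.continuousAt
    have hderiv : deriv φ = ζ := funext fun x => (hd x).deriv
    have hφ : ContDiff ℝ ∞ φ := by
      rw [contDiff_infty_iff_deriv, hderiv]
      exact ⟨fun x => (hd x).differentiableAt, h1⟩
    have hφz : ∀ x, x ∉ Icc p q → φ x = 0 := by
      intro x hx
      rcases lt_or_ge x p with hxp | hxp
      · refine (intervalIntegral.integral_congr (g := fun _ => (0 : ℝ)) ?_).trans (by simp)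
        intro t ht
        refine hz t (Or.inl (lt_of_le_of_lt ht.2 ?_))
        exact max_lt hp0.1 hxp
      · have hqx : q < x := by
          by_contra hn
          exact hx ⟨hxp, not_lt.1 hn⟩
        have hx1 : (-1 : ℝ) ≤ x := hp0.1.le.trans hxp
        change ∫ t in (-1 : ℝ)..x, ζ t = 0
        rw [intervalIntegral.integral_of_le hx1, ← h4]
        refine setIntegral_eq_integral_of_forall_compl_eq_zero ?_
        intro t ht
        refine hz t ?_
        by_contra hn
        push Not at hn
        exact ht ⟨lt_of_lt_of_le hp0.1 hn.1, hn.2.trans hqx.le⟩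
    have hφt : tsupport φ ⊆ Icc p q :=
      closure_minimal (fun x hx => by
        by_contra hn
        exact hx (hφz x hn)) isClosed_Icc
    have hφc : HasCompactSupport φ := isCompact_Icc.of_isClosed_subset (isClosed_tsupport φ) hφt
    have := h φ hφ hφc (hφt.trans fun x hx =>
      ⟨lt_of_lt_of_le hp0.1 hx.1, lt_of_le_of_lt hx.2 hq0.2⟩)
    rw [hderiv] at this
    refine this.trans ?_
    rw [integral_eq_zero_of_ae, neg_zero]
    filter_upwards [Lp.coeFn_zero ℂ 2 (volume.restrict (waveInterval : Set ℝ))] with x hx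
    rw [hx]
    exact smul_zero _
  have hloc : LocallyIntegrableOn (fun x => u x - c) (Ioo (-1 : ℝ) 0) :=
    (locallyIntegrableOn_L2 u).sub (locallyIntegrableOn_const c)
  have hfin := ae_eq_zero_of_test (Ω := waveInterval) (fun x => u x - c) hloc (by
    intro η h1 h2 h3
    have h3' : tsupport η ⊆ Ioo (-1 : ℝ) 0 := h3
    have hIη : Integrable η := h1.continuous.integrable_of_hasCompactSupport h2
    have hIψ : Integrable ψ := hψ1.continuous.integrable_of_hasCompactSupport hψ2
    set m : ℝ := ∫ x, η x with hm
    have ht : tsupport (fun x => η x - m * ψ x) ⊆ tsupport η ∪ tsupport ψ := by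
      refine closure_minimal ?_ ((isClosed_tsupport _).union (isClosed_tsupport _))
      intro x hx
      by_contra hn
      rw [mem_union, not_or] at hn
      apply hx
      simp [image_eq_zero_of_notMem_tsupport hn.1, image_eq_zero_of_notMem_tsupport hn.2]
    have hk := key (fun x => η x - m * ψ x) (h1.sub (contDiff_const.mul hψ1))
      ((h2.isCompact.union hψ2.isCompact).of_isClosed_subset (isClosed_tsupport _) ht)
      (ht.trans (union_subset h3' hψ3))
      (by rw [integral_sub hIη (hIψ.const_mul m), integral_const_mul, hψ4, mul_one, ← hm,
        sub_self])
    have hi1 : Integrable (fun x => η x • u x) (volume.restrict (Ioo (-1 : ℝ) 0)) :=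
      integrable_smul_of_test u h1.continuous h2
    have hi2 : Integrable (fun x => m • (ψ x • u x)) (volume.restrict (Ioo (-1 : ℝ) 0)) :=
      (integrable_smul_of_test u hψ1.continuous hψ2).smul m
    have e1 : ∫ x in Ioo (-1 : ℝ) 0, (η x - m * ψ x) • u x
        = (∫ x in Ioo (-1 : ℝ) 0, η x • u x) - m • c := by
      rw [hc, ← integral_smul, ← integral_sub hi1 hi2]
      refine integral_congr_ae (Eventually.of_forall fun x => ?_)
      simp only [sub_smul, mul_smul]
    have e2 : ∫ x in Ioo (-1 : ℝ) 0, η x • c = m • c := by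
      rw [integral_smul_const, hm]
      congr 1
      refine setIntegral_eq_integral_of_forall_compl_eq_zero fun x hx => ?_
      exact image_eq_zero_of_notMem_tsupport fun hn => hx (h3' hn)
    change ∫ x in Ioo (-1 : ℝ) 0, η x • (u x - c) = 0
    simp only [smul_sub]
    rw [integral_sub hi1 (hIη.smul_const c).restrict, e2, ← e1, hk])
  filter_upwards [hfin] with x hx
  exact sub_eq_zero.1 hx

theorem StateSpace.energyMap_injective : Function.Injective StateSpace.energyMap := by
  rw [injective_iff_map_eq_zero]
  intro x hx
  have h1 : weakDeriv x.u = 0 := congrArg (fun z => z.fst) hx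
  have h2 : x.v = 0 := congrArg (fun z => z.snd.fst) hx
  have h3 : x.w = 0 := congrArg (fun z => z.snd.snd) hx
  refine StateSpace.ext ?_ h2 h3
  have h4 := isWeakDeriv_weakDeriv x.u_mem
  rw [h1] at h4
  obtain ⟨c, hc⟩ := ae_eq_const_of_isWeakDeriv_zero h4
  obtain ⟨U, hU, hUe, hU0⟩ := x.u_left
  have hcl : closure ((waveInterval : TopologicalSpace.Opens ℝ) : Set ℝ) = Icc (-1) 0 :=
    closure_Ioo (by norm_num)
  rw [hcl] at hU
  have hE : U =ᵐ[volume.restrict (Ioo (-1 : ℝ) 0)] fun _ => c := hUe.symm.trans hc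
  have hE' : U =ᵐ[volume.restrict (Icc (-1 : ℝ) 0)] fun _ => c := by
    rwa [← restrict_Ioo_eq_restrict_Icc]
  have := Measure.eqOn_Icc_of_ae_eq volume (by norm_num) hE' hU continuousOn_const
    (left_mem_Icc.2 (by norm_num))
  have hc0 : c = 0 := by rw [← hU0, this]
  rw [StateSpace.u_zero, Lp.eq_zero_iff_ae_eq_zero]
  rw [hc0] at hc
  exact hc

/-- `X` is normed by `‖(u, v, w)‖² = ‖u'‖² + ‖v‖² + ‖w‖²`; see `StateSpace.norm_sq`. -/
instance : NormedAddCommGroup StateSpace :=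
  NormedAddCommGroup.induced StateSpace _ StateSpace.energyMap StateSpace.energyMap_injective

instance : InnerProductSpace ℂ StateSpace := InnerProductSpace.induced StateSpace.energyMap

theorem StateSpace.norm_sq (x : StateSpace) :
    ‖x‖ ^ 2 = ‖weakDeriv x.u‖ ^ 2 + ‖x.v‖ ^ 2 + ‖x.w‖ ^ 2 := by
  change ‖StateSpace.energyMap x‖ ^ 2 = _
  rw [WithLp.prod_norm_sq_eq_of_L2, WithLp.prod_norm_sq_eq_of_L2, add_assoc]
  rfl

/-! ### The generator -/

/-- The domain `D(A)`. -/
def generatorDomain : Submodule ℂ StateSpace where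
  carrier := {x |
    (x.u ∈ sobolevH2 waveInterval ∧ x.v ∈ sobolevH1 waveInterval ∧
      x.w ∈ sobolevH2 heatInterval) ∧
    HasBoundaryValue x.v (-1) 0 ∧
    (∃ c, HasBoundaryValue (weakDeriv x.u) 0 c ∧ HasBoundaryValue (weakDeriv x.w) 0 c) ∧
    ∃ c, HasBoundaryValue x.v 0 c ∧ HasBoundaryValue x.w 0 c}
  add_mem' := by
    rintro x y ⟨⟨hu, hv, hw⟩, h0, ⟨c, hc, hc'⟩, d, hd, hd'⟩
      ⟨⟨ku, kv, kw⟩, k0, ⟨e, he, he'⟩, f, hf, hf'⟩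
    refine ⟨⟨add_mem hu ku, add_mem hv kv, add_mem hw kw⟩, by simpa using h0.add k0,
      ⟨c + e, ?_, ?_⟩, d + f, hd.add hf, hd'.add hf'⟩
    · rw [StateSpace.u_add, weakDeriv_add hu.1 ku.1]
      exact hc.add he
    · rw [StateSpace.w_add, weakDeriv_add hw.1 kw.1]
      exact hc'.add he'
  zero_mem' := by
    refine ⟨⟨zero_mem _, zero_mem _, zero_mem _⟩, HasBoundaryValue.zero _, ⟨0, ?_, ?_⟩, 0,
      HasBoundaryValue.zero _, HasBoundaryValue.zero _⟩
    · rw [StateSpace.u_zero, weakDeriv_zero]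
      exact HasBoundaryValue.zero _
    · rw [StateSpace.w_zero, weakDeriv_zero]
      exact HasBoundaryValue.zero _
  smul_mem' := by
    rintro k x ⟨⟨hu, hv, hw⟩, h0, ⟨c, hc, hc'⟩, d, hd, hd'⟩
    refine ⟨⟨Submodule.smul_mem _ k hu, Submodule.smul_mem _ k hv, Submodule.smul_mem _ k hw⟩,
      by simpa using h0.smul k, ⟨k * c, ?_, ?_⟩, k * d, hd.smul k, hd'.smul k⟩
    · rw [StateSpace.u_smul, weakDeriv_smul k hu.1]
      exact hc.smul k
    · rw [StateSpace.w_smul, weakDeriv_smul k hw.1]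
      exact hc'.smul k

/-- The wave-heat operator `A(u, v, w) = (v, u'', w'')` on `D(A)`. -/
def generator : StateSpace →ₗ.[ℂ] StateSpace where
  domain := generatorDomain
  toFun :=
    { toFun := fun x => StateSpace.mk x.1.v (weakDeriv (weakDeriv x.1.u))
        (weakDeriv (weakDeriv x.1.w)) x.2.1.2.1 x.2.2.1
      map_add' := by
        rintro ⟨x, hx⟩ ⟨y, hy⟩
        refine StateSpace.ext rfl ?_ ?_
        · change weakDeriv (weakDeriv (x.u + y.u)) = _
          rw [weakDeriv_add hx.1.1.1 hy.1.1.1, weakDeriv_add hx.1.1.2 hy.1.1.2]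
          rfl
        · change weakDeriv (weakDeriv (x.w + y.w)) = _
          rw [weakDeriv_add hx.1.2.2.1 hy.1.2.2.1, weakDeriv_add hx.1.2.2.2 hy.1.2.2.2]
          rfl
      map_smul' := by
        rintro k ⟨x, hx⟩
        refine StateSpace.ext rfl ?_ ?_
        · change weakDeriv (weakDeriv (k • x.u)) = _
          rw [weakDeriv_smul k hx.1.1.1, weakDeriv_smul k hx.1.1.2]
          rfl
        · change weakDeriv (weakDeriv (k • x.w)) = _
          rw [weakDeriv_smul k hx.1.2.2.1, weakDeriv_smul k hx.1.2.2.2]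
          rfl }

/-! ### Resolvents of unbounded operators -/

section Resolvent

variable {E : Type*} [NormedAddCommGroup E] [NormedSpace ℂ E]

/-- The bounded operator `R` is a two-sided inverse of `z - A : D(A) → E`. -/
def IsResolventAt (A : E →ₗ.[ℂ] E) (z : ℂ) (R : E →L[ℂ] E) : Prop :=
  (∀ y : E, ∃ h : R y ∈ A.domain, z • R y - A ⟨R y, h⟩ = y) ∧
    ∀ x : A.domain, R (z • (x : E) - A x) = x

/-- The resolvent set `ρ(A)`. -/
def resolventSet (A : E →ₗ.[ℂ] E) : Set ℂ := {z | ∃ R : E →L[ℂ] E, IsResolventAt A z R}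

open Classical in
/-- The resolvent `R(z, A) = (z - A)⁻¹` for `z ∈ ρ(A)` (and `0` otherwise). -/
def resolvent (A : E →ₗ.[ℂ] E) (z : ℂ) : E →L[ℂ] E :=
  if h : ∃ R : E →L[ℂ] E, IsResolventAt A z R then h.choose else 0

theorem isResolventAt_resolvent {A : E →ₗ.[ℂ] E} {z : ℂ} (hz : z ∈ resolventSet A) :
    IsResolventAt A z (resolvent A z) := by
  have h : ∃ R : E →L[ℂ] E, IsResolventAt A z R := hz
  rw [resolvent, dif_pos h]
  exact h.choose_spec

theorem IsResolventAt.unique {A : E →ₗ.[ℂ] E} {z : ℂ} {R S : E →L[ℂ] E}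
    (hR : IsResolventAt A z R) (hS : IsResolventAt A z S) : R = S := by
  ext y
  obtain ⟨h, hy⟩ := hR.1 y
  have := hS.2 ⟨R y, h⟩
  rw [hy] at this
  exact this.symm

end Resolvent

end WaveHeat

end

/-!
Write `λ = i s = μ²` with `Re μ > 0`, so that `μ = r (1 ± i)` and `|s| = 2 r²`. For the right-hand
side `(f, g, h)` the resolvent equation decouples into first-order scalar equations when it is
written for `a = v + u'`, `b = v - u'` and `d = w' + μ w`:
`a' = λ a - (g + f')`, `b' = - λ b + (g - f')`, `d' = μ d - h`, `w' = - μ w + d`.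

The first two are transport equations with bounded propagators, solved from `x = -1`
(`exists_wave_transport`). The third has exactly one solution in `L²(0, ∞)`, obtained by integrating
from infinity (`exists_heat_backward`); its value `H` at `0` turns the transmission conditions into
the single condition `u'(0) + μ v(0) = H` on the wave part. The fourth is then an initial value
problem with decaying exponential (`exists_heat_forward`). On the half-line the `L²` bounds
come from Schur's test.

There remains one scalar equation for `a(-1)`, whose coefficient is
`charFun μ = 2 (cos s + i μ sin s)`. This is bounded away from zero uniformly in `s`
(`half_le_norm_charFun`). Since the data enter that equation with factors of order `1 + |μ|` and
`r^{-1/2}`, this gives a solution bounded by a multiple of `r + r^{-2}` (`exists_solution`,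
`exists_resolvent_bound`), which is `O(|s|^{1/2})` at infinity and `O(|s|⁻¹)` at zero. Uniqueness
(`eq_zero_of_generator_eq`) holds because weak solutions of `u' = κ u` are exponentials
(`ae_eq_exp_of_isWeakDeriv`).
-/

noncomputable section

namespace WaveHeat

/-! ### Primitives of locally integrable functions -/

theorem absolutelyContinuousOnInterval_primitive {g : ℝ → ℂ} (hg : LocallyIntegrable g)
    (p q : ℝ) : AbsolutelyContinuousOnInterval (fun x => ∫ t in p..x, g t) p q := by
  have hi : ∀ x, IntervalIntegrable g volume p x := fun x =>
    (hg.integrableOn_isCompact isCompact_uIcc).intervalIntegrable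
  have hre : ∀ x, IntervalIntegrable (fun t => (g t).re) volume p x := fun x =>
    ⟨(hi x).1.re, (hi x).2.re⟩
  have him : ∀ x, IntervalIntegrable (fun t => (g t).im) volume p x := fun x =>
    ⟨(hi x).1.im, (hi x).2.im⟩
  have hc (z : ℂ) : AbsolutelyContinuousOnInterval (fun _ : ℝ => z) p q :=
    (contDiffOn_const (n := 1)).absolutelyContinuousOnInterval
  have h1 := ((hre q).absolutelyContinuousOnInterval_intervalIntegral left_mem_uIcc).smul (hc 1)
  have h2 := ((him q).absolutelyContinuousOnInterval_intervalIntegral left_mem_uIcc).smul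
    (hc Complex.I)
  convert! h1.add h2 using 1
  ext x
  have : ∀ t, g t = ((g t).re : ℂ) + ((g t).im : ℂ) * Complex.I := fun t =>
    (Complex.re_add_im _).symm
  simp only [Pi.add_apply, Pi.smul_apply', Complex.real_smul, mul_one]
  rw [intervalIntegral.integral_congr (fun t _ => this t), intervalIntegral.integral_add,
    intervalIntegral.integral_mul_const, intervalIntegral.integral_ofReal,
    intervalIntegral.integral_ofReal]
  · exact ⟨(hre x).1.ofReal, (hre x).2.ofReal⟩
  · exact IntervalIntegrable.mul_const ⟨(him x).1.ofReal, (him x).2.ofReal⟩ _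

/-- Integration by parts of a `C¹` function against a primitive. -/
theorem integral_deriv_mul_primitive {φ g : ℝ → ℂ} (hφ : ContDiff ℝ 1 φ)
    (hg : LocallyIntegrable g) (c : ℂ) (α p q : ℝ) :
    ∫ x in p..q, (deriv φ x * (c + ∫ t in α..x, g t) + φ x * g x)
      = φ q * (c + ∫ t in α..q, g t) - φ p * (c + ∫ t in α..p, g t) := by
  have hi : ∀ a b, IntervalIntegrable g volume a b := fun a b =>
    (hg.integrableOn_isCompact isCompact_uIcc).intervalIntegrable
  set P : ℝ → ℂ := fun x => c + ∫ t in α..x, g t with hP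
  have hPc : Continuous P := continuous_const.add (intervalIntegral.continuous_primitive hi α)
  have hPp : P = (fun x => (P p) + ∫ t in p..x, g t) := by
    ext x
    simp only [hP]
    rw [← intervalIntegral.integral_add_adjacent_intervals (hi α p) (hi p x), add_assoc]
  have hconst (z : ℂ) : AbsolutelyContinuousOnInterval (fun _ : ℝ => z) p q :=
    (contDiffOn_const (n := 1)).absolutelyContinuousOnInterval
  have hPac : AbsolutelyContinuousOnInterval P p q := by
    rw [hPp]
    exact (hconst _).add (absolutelyContinuousOnInterval_primitive hg p q)
  set k : ℝ → ℂ := fun x => deriv φ x * P x + φ x * g x with hk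
  have hkl : LocallyIntegrable k := by
    refine LocallyIntegrable.add ?_ ?_
    · exact ((hφ.continuous_deriv le_rfl).mul hPc).locallyIntegrable
    · rw [← locallyIntegrableOn_univ] at hg ⊢
      exact hg.continuousOn_mul hφ.continuous.continuousOn isClosed_univ.isLocallyClosed
  have hQac := absolutelyContinuousOnInterval_primitive hkl p q
  have hφac : AbsolutelyContinuousOnInterval φ p q :=
    hφ.contDiffOn.absolutelyContinuousOnInterval
  -- `φ P` and the primitive of `k` are absolutely continuous with equal derivatives a.e.
  obtain ⟨C, hC⟩ := AbsolutelyContinuousOnInterval.const_of_ae_hasDerivAt_zero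
    ((hφac.smul hPac).sub hQac) (by
      filter_upwards [_root_.LocallyIntegrable.ae_hasDerivAt_integral hg,
        _root_.LocallyIntegrable.ae_hasDerivAt_integral hkl] with x h1 h2 _
      have h3 : HasDerivAt φ (deriv φ x) x :=
        ((hφ.differentiable one_ne_zero) x).hasDerivAt
      have h4 : HasDerivAt P (g x) x := (h1 α).const_add c
      have := (h3.mul h4).sub (h2 p)
      simpa [hk] using this)
  have e1 := hC p left_mem_uIcc
  have e2 := hC q right_mem_uIcc
  simp only [Pi.sub_apply, smul_eq_mul, Pi.mul_apply, intervalIntegral.integral_same,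
    sub_zero] at e1 e2
  rw [e1, ← e2]
  ring

theorem integral_deriv_mul_primitive_of_hasCompactSupport {φ g : ℝ → ℂ} (hφ : ContDiff ℝ 1 φ)
    (hs : HasCompactSupport φ) (hg : LocallyIntegrable g) (c : ℂ) (α : ℝ) :
    ∫ x, deriv φ x * (c + ∫ t in α..x, g t) = - ∫ x, φ x * g x := by
  have hi : ∀ a b, IntervalIntegrable g volume a b := fun a b =>
    (hg.integrableOn_isCompact isCompact_uIcc).intervalIntegrable
  have hPc : Continuous fun x => c + ∫ t in α..x, g t :=
    continuous_const.add (intervalIntegral.continuous_primitive hi α)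
  obtain ⟨R, hR⟩ := hs.isCompact.isBounded.subset_ball 0
  rw [Real.ball_eq_Ioo, zero_sub, zero_add] at hR
  have hz : ∀ x, x ∉ Ioo (-R) R → φ x = 0 := fun x hx =>
    image_eq_zero_of_notMem_tsupport fun h => hx (hR h)
  have hsub : Function.support φ ⊆ Ioc (-R) R :=
    (subset_tsupport φ).trans (hR.trans Ioo_subset_Ioc_self)
  have hsub' : Function.support (deriv φ) ⊆ Ioc (-R) R :=
    (support_deriv_subset).trans (hR.trans Ioo_subset_Ioc_self)
  have h := integral_deriv_mul_primitive hφ hg c α (-R) R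
  rw [hz R (by simp), hz (-R) (by simp), zero_mul, zero_mul, sub_zero,
    intervalIntegral.integral_add] at h
  · rw [← intervalIntegral.integral_eq_integral_of_support_subset (a := -R) (b := R),
      ← intervalIntegral.integral_eq_integral_of_support_subset (a := -R) (b := R)]
    · exact eq_neg_of_add_eq_zero_left h
    · exact (Function.support_mul_subset_left _ _).trans hsub
    · exact (Function.support_mul_subset_left _ _).trans hsub'
  · exact ((hφ.continuous_deriv le_rfl).mul hPc).intervalIntegrable _ _
  · exact (hi _ _).continuousOn_mul hφ.continuous.continuousOn

/-! ### First-order equations -/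

/-- The solution `y(x) = e^{κ x} (c + ∫_α^x e^{-κ t} k(t) dt)` of `y' = κ y + k`. -/
def duhamel (κ c : ℂ) (α : ℝ) (k : ℝ → ℂ) (x : ℝ) : ℂ :=
  Complex.exp (κ * x) * (c + ∫ t in α..x, Complex.exp (-κ * t) * k t)

theorem contDiff_cexp_mul (κ : ℂ) {n : WithTop ℕ∞} :
    ContDiff ℝ n fun x : ℝ => Complex.exp (κ * x) :=
  (contDiff_const.mul Complex.ofRealCLM.contDiff).cexp

theorem hasDerivAt_cexp_mul (κ : ℂ) (x : ℝ) :
    HasDerivAt (fun x : ℝ => Complex.exp (κ * x)) (κ * Complex.exp (κ * x)) x := by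
  have h := ((hasDerivAt_id (x : ℂ)).const_mul κ).cexp.comp_ofReal
  simpa [mul_comm] using h

theorem locallyIntegrable_exp_mul (κ : ℂ) {k : ℝ → ℂ} (hk : LocallyIntegrable k) :
    LocallyIntegrable fun t : ℝ => Complex.exp (κ * t) * k t := by
  rw [← locallyIntegrableOn_univ] at hk ⊢
  exact hk.continuousOn_mul (contDiff_cexp_mul κ (n := 1)).continuous.continuousOn
    isClosed_univ.isLocallyClosed

theorem continuous_duhamel (κ c : ℂ) (α : ℝ) {k : ℝ → ℂ} (hk : LocallyIntegrable k) :
    Continuous (duhamel κ c α k) := by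
  have hl := locallyIntegrable_exp_mul (-κ) hk
  exact (contDiff_cexp_mul κ (n := 1)).continuous.mul (continuous_const.add
    (intervalIntegral.continuous_primitive
      (fun a b => (hl.integrableOn_isCompact isCompact_uIcc).intervalIntegrable) α))

theorem integral_deriv_smul_duhamel (κ c : ℂ) (α : ℝ) {k : ℝ → ℂ} (hk : LocallyIntegrable k)
    {φ : ℝ → ℝ} (hφ : ContDiff ℝ ∞ φ) (hs : HasCompactSupport φ) :
    ∫ x, deriv φ x • duhamel κ c α k x
      = - ∫ x, φ x • (κ * duhamel κ c α k x + k x) := by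
  set y := duhamel κ c α k with hy
  have hyc : Continuous y := continuous_duhamel κ c α hk
  set Φ : ℝ → ℂ := fun x => Complex.exp (κ * x) * (φ x : ℂ) with hΦ
  have hφd : ∀ x, HasDerivAt φ (deriv φ x) x := fun x =>
    (hφ.differentiable (by simp) x).hasDerivAt
  have hΦd : ∀ x, deriv Φ x = κ * Φ x + Complex.exp (κ * x) * ((deriv φ x : ℝ) : ℂ) := fun x => by
    refine ((hasDerivAt_cexp_mul κ x).mul (hφd x).ofReal_comp).deriv.trans ?_
    simp only [hΦ]
    ring
  have hΦs : HasCompactSupport Φ := by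
    have : HasCompactSupport fun x => (φ x : ℂ) :=
      hs.comp_left (g := fun r : ℝ => (r : ℂ)) (by simp)
    exact this.mul_left
  have hΦ1 : ContDiff ℝ 1 Φ :=
    (contDiff_cexp_mul κ).mul (Complex.ofRealCLM.contDiff.comp (hφ.of_le (by simp)))
  have h := integral_deriv_mul_primitive_of_hasCompactSupport hΦ1 hΦs
    (locallyIntegrable_exp_mul (-κ) hk) c α
  have hyI (ψ : ℝ → ℝ) (h1 : Continuous ψ) (h2 : HasCompactSupport ψ) :
      Integrable fun x => ψ x • y x :=
    (h1.smul hyc).integrable_of_hasCompactSupport h2.smul_right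
  have hkI : Integrable fun x => φ x • k x :=
    hk.integrable_smul_left_of_hasCompactSupport hφ.continuous hs
  have e1 : ∀ x, deriv Φ x * (c + ∫ t in α..x, Complex.exp (-κ * t) * k t)
      = κ * (φ x • y x) + deriv φ x • y x := fun x => by
    rw [hΦd, hy, duhamel]
    simp only [hΦ, Complex.real_smul]
    ring
  have e2 : ∀ x, Φ x * (Complex.exp (-κ * x) * k x) = φ x • k x := fun x => by
    have : Complex.exp (κ * x) * Complex.exp (-κ * x) = 1 := by
      rw [← Complex.exp_add]
      simp
    simp only [hΦ, Complex.real_smul]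
    linear_combination (φ x : ℂ) * k x * this
  have e3 : ∀ x, φ x • (κ * y x + k x) = κ * (φ x • y x) + φ x • k x := fun x => by
    simp only [Complex.real_smul]
    ring
  simp only [e1, e2] at h
  have i1 := (hyI φ hφ.continuous hs).const_mul κ
  have i2 := hyI (deriv φ) (hφ.continuous_deriv (by simp)) hs.deriv
  rw [integral_add i1 i2] at h
  simp only [e3]
  rw [integral_add i1 hkI]
  linear_combination h

variable {Ω : TopologicalSpace.Opens ℝ}

theorem locallyIntegrable_indicator (k : L2 Ω) :
    LocallyIntegrable ((Ω : Set ℝ).indicator k) := by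
  have h : MemLp ((Ω : Set ℝ).indicator k) 2 volume :=
    (memLp_indicator_iff_restrict Ω.isOpen.measurableSet).2 (Lp.memLp k)
  exact h.locallyIntegrable (by norm_num)

/-- The Duhamel formula is a weak solution of `u' = κ u + k`. The integrand is extended by zero
outside `Ω`, where the values of the chosen representative of `k` are meaningless. -/
theorem isWeakDeriv_of_ae_eq_duhamel {κ c : ℂ} {α : ℝ} {k u : L2 Ω}
    (hu : u =ᵐ[volume.restrict (Ω : Set ℝ)] duhamel κ c α ((Ω : Set ℝ).indicator k)) :
    IsWeakDeriv u (κ • u + k) := by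
  intro φ hφ hs ht
  have h := integral_deriv_smul_duhamel κ c α (locallyIntegrable_indicator k) hφ hs
  have hz : ∀ x, x ∉ (Ω : Set ℝ) → φ x = 0 := fun x hx =>
    image_eq_zero_of_notMem_tsupport fun h => hx (ht h)
  have hz' : ∀ x, x ∉ (Ω : Set ℝ) → deriv φ x = 0 := fun x hx => by
    by_contra h0
    exact hx (ht (support_deriv_subset h0))
  rw [← setIntegral_eq_integral_of_forall_compl_eq_zero (s := (Ω : Set ℝ))
      (fun x hx => by rw [hz' x hx, zero_smul]),
    ← setIntegral_eq_integral_of_forall_compl_eq_zero (s := (Ω : Set ℝ))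
      (f := fun x => φ x • _) (fun x hx => by rw [hz x hx, zero_smul])] at h
  refine Eq.trans (integral_congr_ae ?_) (h.trans (congrArg _ (integral_congr_ae ?_)))
  · filter_upwards [hu] with x hx
    rw [hx]
  · filter_upwards [hu, Lp.coeFn_add (κ • u) k, Lp.coeFn_smul κ u,
      ae_restrict_mem Ω.isOpen.measurableSet] with x h1 h2 h3 h4
    rw [h2, Pi.add_apply, h3, Pi.smul_apply, ← h1, indicator_of_mem h4, smul_eq_mul]

/-! ### Uniqueness for first-order equations -/

/-- A test function of vanishing integral on an interval is the derivative of a test function on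
the same interval: its primitive vanishes outside the convex hull of its support. -/
theorem exists_test_deriv_eq (hΩ : (Ω : Set ℝ).OrdConnected) {ζ : ℝ → ℝ} (h1 : ContDiff ℝ ∞ ζ)
    (h2 : HasCompactSupport ζ) (h3 : tsupport ζ ⊆ (Ω : Set ℝ)) (h4 : ∫ x, ζ x = 0)
    (hne : (tsupport ζ).Nonempty) :
    ∃ φ : ℝ → ℝ, ContDiff ℝ ∞ φ ∧ HasCompactSupport φ ∧ tsupport φ ⊆ (Ω : Set ℝ) ∧
      deriv φ = ζ := by
  obtain ⟨p, hp, hp'⟩ := h2.isCompact.exists_isLeast hne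
  obtain ⟨q, hq, hq'⟩ := h2.isCompact.exists_isGreatest hne
  have hz : ∀ x, x < p ∨ q < x → ζ x = 0 := by
    intro x hx
    refine image_eq_zero_of_notMem_tsupport fun hm => ?_
    rcases hx with hx | hx
    · exact absurd (hp' hm) (not_le.2 hx)
    · exact absurd (hq' hm) (not_le.2 hx)
  have hcont : Continuous ζ := h1.continuous
  let φ : ℝ → ℝ := fun x => ∫ t in (p - 1)..x, ζ t
  have hd : ∀ x, HasDerivAt φ (ζ x) x := fun x =>
    intervalIntegral.integral_hasDerivAt_right (hcont.intervalIntegrable _ _)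
      (hcont.stronglyMeasurableAtFilter _ _) hcont.continuousAt
  have hderiv : deriv φ = ζ := funext fun x => (hd x).deriv
  have hφ : ContDiff ℝ ∞ φ := by
    rw [contDiff_infty_iff_deriv, hderiv]
    exact ⟨fun x => (hd x).differentiableAt, h1⟩
  have hφz : ∀ x, x ∉ Icc p q → φ x = 0 := by
    intro x hx
    rcases lt_or_ge x p with hxp | hxp
    · refine (intervalIntegral.integral_congr (g := fun _ => (0 : ℝ)) ?_).trans (by simp)
      intro t ht
      exact hz t (Or.inl (lt_of_le_of_lt ht.2 (max_lt (by linarith) hxp)))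
    · have hqx : q < x := by
        by_contra hn
        exact hx ⟨hxp, not_lt.1 hn⟩
      change ∫ t in (p - 1)..x, ζ t = 0
      rw [← h4]
      refine intervalIntegral.integral_eq_integral_of_support_subset fun t ht => ?_
      by_contra hn
      refine ht (hz t ?_)
      by_contra hn'
      push Not at hn'
      exact hn ⟨by linarith, by linarith⟩
  have hφt : tsupport φ ⊆ Icc p q :=
    closure_minimal (fun x hx => by
      by_contra hn
      exact hx (hφz x hn)) isClosed_Icc
  exact ⟨φ, hφ, isCompact_Icc.of_isClosed_subset (isClosed_tsupport φ) hφt,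
    hφt.trans (hΩ.out (h3 hp) (h3 hq)), hderiv⟩

/-- A locally integrable function on an interval whose weak derivative vanishes is constant. -/
theorem ae_eq_const_of_integral_deriv_smul_eq_zero (hΩ : (Ω : Set ℝ).OrdConnected)
    (hne : (Ω : Set ℝ).Nonempty) {f : ℝ → ℂ}
    (hf : LocallyIntegrable f (volume.restrict (Ω : Set ℝ)))
    (h : ∀ φ : ℝ → ℝ, ContDiff ℝ ∞ φ → HasCompactSupport φ → tsupport φ ⊆ (Ω : Set ℝ) →
      ∫ x in (Ω : Set ℝ), deriv φ x • f x = 0) :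
    ∃ c : ℂ, f =ᵐ[volume.restrict (Ω : Set ℝ)] fun _ => c := by
  obtain ⟨x₀, hx₀⟩ := hne
  obtain ⟨ε, hε, hball⟩ := Metric.isOpen_iff.1 Ω.isOpen x₀ hx₀
  let b : ContDiffBump x₀ := ⟨ε / 4, ε / 2, by linarith, by linarith⟩
  let ψ : ℝ → ℝ := b.normed volume
  have hψ1 : ContDiff ℝ ∞ ψ := b.contDiff_normed
  have hψ2 : HasCompactSupport ψ := b.hasCompactSupport_normed
  have hψ3 : tsupport ψ ⊆ (Ω : Set ℝ) := by
    rw [b.tsupport_normed_eq]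
    exact (Metric.closedBall_subset_ball (by change ε / 2 < ε; linarith)).trans hball
  have hψ4 : ∫ x, ψ x = 1 := b.integral_normed
  refine ⟨∫ x in (Ω : Set ℝ), ψ x • f x, ?_⟩
  set c : ℂ := ∫ x in (Ω : Set ℝ), ψ x • f x with hc
  have key : ∀ ζ : ℝ → ℝ, ContDiff ℝ ∞ ζ → HasCompactSupport ζ → tsupport ζ ⊆ (Ω : Set ℝ) →
      ∫ x, ζ x = 0 → ∫ x in (Ω : Set ℝ), ζ x • f x = 0 := by
    intro ζ h1 h2 h3 h4
    rcases (tsupport ζ).eq_empty_or_nonempty with he | hne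
    · rw [tsupport_eq_empty_iff.1 he]
      simp
    · obtain ⟨φ, hφ, hφs, hφt, rfl⟩ := exists_test_deriv_eq hΩ h1 h2 h3 h4 hne
      exact h φ hφ hφs hφt
  have hloc : LocallyIntegrableOn (fun x => f x - c) (Ω : Set ℝ) :=
    (locallyIntegrableOn_of_locallyIntegrable_restrict hf).sub (locallyIntegrableOn_const c)
  -- subtracting a multiple of the normalized bump makes the integral of a test function vanish
  have hfin := ae_eq_zero_of_test (Ω := Ω) (fun x => f x - c) hloc (by
    intro η h1 h2 h3
    have hIη : Integrable η := h1.continuous.integrable_of_hasCompactSupport h2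
    have hIψ : Integrable ψ := hψ1.continuous.integrable_of_hasCompactSupport hψ2
    set m : ℝ := ∫ x, η x with hm
    have ht : tsupport (fun x => η x - m * ψ x) ⊆ tsupport η ∪ tsupport ψ := by
      refine closure_minimal ?_ ((isClosed_tsupport _).union (isClosed_tsupport _))
      intro x hx
      by_contra hn
      rw [mem_union, not_or] at hn
      apply hx
      simp [image_eq_zero_of_notMem_tsupport hn.1, image_eq_zero_of_notMem_tsupport hn.2]
    have hk := key (fun x => η x - m * ψ x) (h1.sub (contDiff_const.mul hψ1))
      ((h2.isCompact.union hψ2.isCompact).of_isClosed_subset (isClosed_tsupport _) ht)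
      (ht.trans (union_subset h3 hψ3))
      (by rw [integral_sub hIη (hIψ.const_mul m), integral_const_mul, hψ4, mul_one, ← hm,
        sub_self])
    have hi1 : Integrable (fun x => η x • f x) (volume.restrict (Ω : Set ℝ)) :=
      hf.integrable_smul_left_of_hasCompactSupport h1.continuous h2
    have hi2 : Integrable (fun x => m • (ψ x • f x)) (volume.restrict (Ω : Set ℝ)) :=
      (hf.integrable_smul_left_of_hasCompactSupport hψ1.continuous hψ2).smul m
    have e1 : ∫ x in (Ω : Set ℝ), (η x - m * ψ x) • f x
        = (∫ x in (Ω : Set ℝ), η x • f x) - m • c := by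
      rw [hc, ← integral_smul, ← integral_sub hi1 hi2]
      refine integral_congr_ae (Eventually.of_forall fun x => ?_)
      simp only [sub_smul, mul_smul]
    have e2 : ∫ x in (Ω : Set ℝ), η x • c = m • c := by
      rw [integral_smul_const, hm]
      congr 1
      refine setIntegral_eq_integral_of_forall_compl_eq_zero fun x hx => ?_
      exact image_eq_zero_of_notMem_tsupport fun hn => hx (h3 hn)
    simp only [smul_sub]
    rw [integral_sub hi1 (hIη.smul_const c).restrict, e2, ← e1, hk])
  filter_upwards [hfin] with x hx
  exact sub_eq_zero.1 hx

/-- The defining identity of the weak derivative for complex-valued test functions. -/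
theorem IsWeakDeriv.integral_deriv_mul {u g : L2 Ω} (h : IsWeakDeriv u g) {Φ : ℝ → ℂ}
    (hΦ : ContDiff ℝ ∞ Φ) (hs : HasCompactSupport Φ) (ht : tsupport Φ ⊆ (Ω : Set ℝ)) :
    ∫ x in (Ω : Set ℝ), deriv Φ x * u x = - ∫ x in (Ω : Set ℝ), Φ x * g x := by
  have hd : ∀ x, HasDerivAt Φ (deriv Φ x) x := fun x =>
    (hΦ.differentiable (by simp) x).hasDerivAt
  have key : ∀ L : ℂ →L[ℝ] ℝ, ContDiff ℝ ∞ (fun x => L (Φ x)) ∧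
      HasCompactSupport (fun x => L (Φ x)) ∧ deriv (fun x => L (Φ x)) = (fun x => L (deriv Φ x)) ∧
      ∫ x in (Ω : Set ℝ), L (deriv Φ x) • u x = - ∫ x in (Ω : Set ℝ), L (Φ x) • g x := by
    intro L
    have hdL : deriv (fun x => L (Φ x)) = fun x => L (deriv Φ x) :=
      funext fun x => (L.hasFDerivAt.comp_hasDerivAt x (hd x)).deriv
    have h1 : ContDiff ℝ ∞ (fun x => L (Φ x)) := L.contDiff.comp hΦ
    have h2 : HasCompactSupport (fun x => L (Φ x)) := hs.comp_left (g := L) (map_zero L)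
    refine ⟨h1, h2, hdL, ?_⟩
    have := h (fun x => L (Φ x)) h1 h2
      ((closure_mono (show Function.support (fun x => L (Φ x)) ⊆ Function.support Φ from
        fun x hx h0 => hx (by simp [h0]))).trans ht)
    rwa [hdL] at this
  obtain ⟨r1, r2, r3, r4⟩ := key Complex.reCLM
  obtain ⟨i1, i2, i3, i4⟩ := key Complex.imCLM
  have er := integrable_smul_of_test u (r3 ▸ r1.continuous_deriv (by simp)) (r3 ▸ r2.deriv)
  have ei := integrable_smul_of_test u (i3 ▸ i1.continuous_deriv (by simp)) (i3 ▸ i2.deriv)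
  have fr := integrable_smul_of_test g r1.continuous r2
  have fi := integrable_smul_of_test g i1.continuous i2
  have split : ∀ z w : ℂ, z * w
      = Complex.reCLM z • w + Complex.I * (Complex.imCLM z • w) := fun z w => by
    simp only [Complex.reCLM_apply, Complex.imCLM_apply, Complex.real_smul]
    nth_rewrite 1 [← Complex.re_add_im z]
    ring
  simp only [fun x => split (deriv Φ x) (u x), fun x => split (Φ x) (g x)]
  rw [integral_add er (ei.const_mul _), integral_add fr (fi.const_mul _), integral_const_mul,
    integral_const_mul, r4, i4]
  ring

/-- A weak solution of `u' = κ u` on an interval is a multiple of `e^{κ x}`. -/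
theorem ae_eq_exp_of_isWeakDeriv (hΩ : (Ω : Set ℝ).OrdConnected) (hne : (Ω : Set ℝ).Nonempty)
    {u : L2 Ω} {κ : ℂ} (h : IsWeakDeriv u (κ • u)) :
    ∃ c : ℂ, u =ᵐ[volume.restrict (Ω : Set ℝ)] fun x => c * Complex.exp (κ * x) := by
  have hexp : Continuous fun x : ℝ => Complex.exp (-κ * x) :=
    (contDiff_cexp_mul (-κ) (n := 1)).continuous
  have hu : LocallyIntegrable u (volume.restrict (Ω : Set ℝ)) :=
    (Lp.memLp u).locallyIntegrable (by norm_num)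
  have hloc : LocallyIntegrable (fun x : ℝ => Complex.exp (-κ * x) * u x)
      (volume.restrict (Ω : Set ℝ)) := by
    rw [← locallyIntegrableOn_univ] at hu ⊢
    exact hu.continuousOn_mul hexp.continuousOn isClosed_univ.isLocallyClosed
  obtain ⟨c, hc⟩ := ae_eq_const_of_integral_deriv_smul_eq_zero hΩ hne hloc (by
    intro φ hφ hs ht
    -- testing `u' = κ u` with `e^{-κ x} φ` shows that `e^{-κ x} u` has vanishing weak derivative
    set Φ : ℝ → ℂ := fun x => Complex.exp (-κ * x) * (φ x : ℂ) with hΦ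
    have hφd : ∀ x, HasDerivAt φ (deriv φ x) x := fun x =>
      (hφ.differentiable (by simp) x).hasDerivAt
    have hΦd : ∀ x, deriv Φ x
        = -κ * Φ x + Complex.exp (-κ * x) * ((deriv φ x : ℝ) : ℂ) := fun x => by
      refine ((hasDerivAt_cexp_mul (-κ) x).mul (hφd x).ofReal_comp).deriv.trans ?_
      simp only [hΦ]
      ring
    have hφs : HasCompactSupport fun x => (φ x : ℂ) :=
      hs.comp_left (g := fun r : ℝ => (r : ℂ)) (by simp)
    have hΦ1 : ContDiff ℝ ∞ Φ :=
      (contDiff_cexp_mul (-κ)).mul (Complex.ofRealCLM.contDiff.comp hφ)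
    have hΦs : HasCompactSupport Φ := hφs.mul_left
    have hΦt : tsupport Φ ⊆ (Ω : Set ℝ) :=
      (closure_mono (show Function.support Φ ⊆ Function.support φ from
        fun x hx h0 => hx (by simp [hΦ, h0]))).trans ht
    have hk := h.integral_deriv_mul hΦ1 hΦs hΦt
    have i1 : Integrable (fun x => φ x • (Complex.exp (-κ * x) * u x))
        (volume.restrict (Ω : Set ℝ)) :=
      hloc.integrable_smul_left_of_hasCompactSupport hφ.continuous hs
    have i2 : Integrable (fun x => deriv φ x • (Complex.exp (-κ * x) * u x))
        (volume.restrict (Ω : Set ℝ)) :=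
      hloc.integrable_smul_left_of_hasCompactSupport (hφ.continuous_deriv (by simp)) hs.deriv
    have e1 : ∀ x, deriv Φ x * u x = -κ * (φ x • (Complex.exp (-κ * x) * u x))
        + deriv φ x • (Complex.exp (-κ * x) * u x) := fun x => by
      rw [hΦd]
      simp only [hΦ, Complex.real_smul]
      ring
    have e2 : ∫ x in (Ω : Set ℝ), Φ x * (κ • u : L2 Ω) x
        = ∫ x in (Ω : Set ℝ), κ * (φ x • (Complex.exp (-κ * x) * u x)) := by
      refine integral_congr_ae ?_
      filter_upwards [Lp.coeFn_smul κ u] with x hx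
      rw [hx, Pi.smul_apply, smul_eq_mul, Complex.real_smul]
      simp only [hΦ]
      ring
    simp only [e1] at hk
    rw [e2, integral_add (i1.const_mul _) i2, integral_const_mul, integral_const_mul] at hk
    linear_combination hk)
  refine ⟨c, ?_⟩
  filter_upwards [hc] with x hx
  have : Complex.exp (κ * x) * Complex.exp (-κ * x) = 1 := by
    rw [← Complex.exp_add]
    simp
  rw [← hx]
  linear_combination (-u x) * this

/-! ### Boundary values -/

theorem HasBoundaryValue.unique {u : L2 Ω} {a : ℝ} {c d : ℂ} (ha : a ∈ closure (Ω : Set ℝ))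
    (hc : HasBoundaryValue u a c) (hd : HasBoundaryValue u a d) : c = d := by
  obtain ⟨U, hU, hUe, rfl⟩ := hc
  obtain ⟨V, hV, hVe, rfl⟩ := hd
  have h1 : EqOn U V (Ω : Set ℝ) :=
    Measure.eqOn_open_of_ae_eq (hUe.symm.trans hVe) Ω.isOpen (hU.mono subset_closure)
      (hV.mono subset_closure)
  exact h1.of_subset_closure hU hV subset_closure subset_rfl ha

theorem hasBoundaryValue_of_ae_eq {u : L2 Ω} {U : ℝ → ℂ} (hU : Continuous U)
    (h : u =ᵐ[volume.restrict (Ω : Set ℝ)] U) (a : ℝ) : HasBoundaryValue u a (U a) :=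
  ⟨U, hU.continuousOn, h, rfl⟩

theorem closure_waveInterval : closure (waveInterval : Set ℝ) = Icc (-1) 0 :=
  closure_Ioo (by norm_num)

theorem closure_heatInterval : closure (heatInterval : Set ℝ) = Ici 0 := closure_Ioi 0

/-! ### Square-integrable solutions on the half-line -/

/-- Schur's test for `L²` boundedness of an integral operator with a nonnegative kernel. -/
theorem lintegral_sq_lintegral_mul_le {K : ℝ → ℝ → ENNReal} (hK : Measurable (Function.uncurry K))
    {C : ENNReal} (h1 : ∀ x, ∫⁻ t, K x t ≤ C) (h2 : ∀ t, ∫⁻ x, K x t ≤ C) {f : ℝ → ENNReal}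
    (hf : AEMeasurable f) :
    ∫⁻ x, (∫⁻ t, K x t * f t) ^ 2 ≤ C ^ 2 * ∫⁻ t, f t ^ 2 := by
  have hKx : ∀ x, Measurable (K x) := fun x => hK.comp measurable_prodMk_left
  have hKt : ∀ t, Measurable fun x => K x t := fun t => hK.comp measurable_prodMk_right
  have hsq : ∀ a : ENNReal, (a ^ (1 / 2 : ℝ)) ^ (2 : ℝ) = a := fun a => by
    rw [← ENNReal.rpow_mul]
    norm_num
  have hsq' : ∀ a : ENNReal, (a ^ (1 / 2 : ℝ)) ^ 2 = a := fun a => by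
    rw [← ENNReal.rpow_two, hsq]
  have cs : ∀ x, (∫⁻ t, K x t * f t) ^ 2 ≤ C * ∫⁻ t, K x t * f t ^ 2 := by
    intro x
    have hm : AEMeasurable fun t => K x t ^ (1 / 2 : ℝ) :=
      ((hKx x).pow_const _).aemeasurable
    have h := ENNReal.lintegral_mul_le_Lp_mul_Lq volume Real.HolderConjugate.two_two
      (f := fun t => K x t ^ (1 / 2 : ℝ)) (g := fun t => K x t ^ (1 / 2 : ℝ) * f t)
      hm (hm.mul hf)
    have e : ∀ t, ((fun t => K x t ^ (1 / 2 : ℝ)) * fun t => K x t ^ (1 / 2 : ℝ) * f t) t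
        = K x t * f t := fun t => by
      rw [Pi.mul_apply, ← mul_assoc, ← sq, hsq']
    simp only [e, hsq, ENNReal.mul_rpow_of_nonneg _ _ zero_le_two] at h
    calc (∫⁻ t, K x t * f t) ^ 2
        ≤ ((∫⁻ t, K x t) ^ (1 / 2 : ℝ) * (∫⁻ t, K x t * f t ^ (2 : ℝ)) ^ (1 / 2 : ℝ)) ^ 2 := by
          gcongr
      _ = (∫⁻ t, K x t) * ∫⁻ t, K x t * f t ^ 2 := by
          simp only [mul_pow, hsq', ENNReal.rpow_two]
      _ ≤ _ := by gcongr; exact h1 x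
  have hm2 : AEMeasurable (Function.uncurry fun x t => K x t * f t ^ 2)
      ((volume : Measure ℝ).prod volume) :=
    hK.aemeasurable.mul ((hf.pow_const 2).comp_snd)
  calc ∫⁻ x, (∫⁻ t, K x t * f t) ^ 2
      ≤ ∫⁻ x, C * ∫⁻ t, K x t * f t ^ 2 := lintegral_mono cs
    _ = C * ∫⁻ x, ∫⁻ t, K x t * f t ^ 2 := lintegral_const_mul'' _ hm2.lintegral_prod_right'
    _ = C * ∫⁻ t, ∫⁻ x, K x t * f t ^ 2 := by rw [lintegral_lintegral_swap hm2]
    _ = C * ∫⁻ t, (∫⁻ x, K x t) * f t ^ 2 := by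
        simp only [lintegral_mul_const _ (hKt _)]
    _ ≤ C * ∫⁻ t, C * f t ^ 2 := by
        gcongr with t
        exact h2 t
    _ = C ^ 2 * ∫⁻ t, f t ^ 2 := by
        rw [lintegral_const_mul'' _ (hf.pow_const 2), ← mul_assoc, sq]

theorem eLpNorm_two_sq {μ : Measure ℝ} (Y : ℝ → ℂ) : eLpNorm Y 2 μ ^ 2 = ∫⁻ x, ‖Y x‖ₑ ^ 2 ∂μ := by
  rw [eLpNorm_eq_lintegral_rpow_enorm_toReal two_ne_zero ENNReal.ofNat_ne_top]
  simp only [ENNReal.toReal_ofNat, ENNReal.rpow_two]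
  rw [← ENNReal.rpow_two, ← ENNReal.rpow_mul]
  norm_num

/-- Schur's test for a function on `Ω` that is dominated by an integral operator applied to an
element of `L²(Ω)`. -/
theorem eLpNorm_le_of_enorm_le_lintegral {K : ℝ → ℝ → ENNReal}
    (hK : Measurable (Function.uncurry K)) {C : ENNReal} (h1 : ∀ x, ∫⁻ t, K x t ≤ C)
    (h2 : ∀ t, ∫⁻ x, K x t ≤ C) (k : L2 Ω) {Y : ℝ → ℂ}
    (hY : ∀ x ∈ (Ω : Set ℝ), ‖Y x‖ₑ ≤ ∫⁻ t, K x t * ‖(Ω : Set ℝ).indicator k t‖ₑ) :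
    eLpNorm Y 2 (volume.restrict (Ω : Set ℝ)) ≤ C * ‖k‖ₑ := by
  have hΩ := Ω.isOpen.measurableSet
  have hf : AEMeasurable fun t => ‖(Ω : Set ℝ).indicator k t‖ₑ :=
    ((aestronglyMeasurable_indicator_iff hΩ).2 (Lp.aestronglyMeasurable k)).enorm
  have h := lintegral_sq_lintegral_mul_le hK h1 h2 hf
  have e : ∫⁻ t, ‖(Ω : Set ℝ).indicator k t‖ₑ ^ 2 = ‖k‖ₑ ^ 2 := by
    rw [← eLpNorm_two_sq, eLpNorm_indicator_eq_eLpNorm_restrict hΩ, Lp.enorm_def]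
  rw [e, ← mul_pow] at h
  refine (ENNReal.pow_le_pow_left_iff two_ne_zero).1 (le_trans ?_ h)
  rw [eLpNorm_two_sq]
  calc ∫⁻ x in (Ω : Set ℝ), ‖Y x‖ₑ ^ 2
      ≤ ∫⁻ x in (Ω : Set ℝ), (∫⁻ t, K x t * ‖(Ω : Set ℝ).indicator k t‖ₑ) ^ 2 :=
        setLIntegral_mono' hΩ fun x hx => by gcongr; exact hY x hx
    _ ≤ _ := setLIntegral_le_lintegral _ _

/-- The kernel `y ↦ 1_{y ≥ 0} e^{-r y}`. -/
def expKernel (r y : ℝ) : ENNReal :=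
  (Ici (0 : ℝ)).indicator (fun y => ENNReal.ofReal (Real.exp (-r * y))) y

theorem measurable_expKernel (r : ℝ) : Measurable (expKernel r) :=
  Measurable.indicator (by fun_prop) measurableSet_Ici

theorem lintegral_exp_Ioi {r : ℝ} (hr : 0 < r) :
    ∫⁻ y in Ioi 0, ENNReal.ofReal (Real.exp (-r * y)) = ENNReal.ofReal r⁻¹ := by
  rw [← ofReal_integral_eq_lintegral_ofReal (integrableOn_exp_mul_Ioi (by linarith) 0)
    (Eventually.of_forall fun x => (Real.exp_pos _).le), integral_exp_mul_Ioi (by linarith)]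
  congr 1
  simp [neg_div_neg_eq]

theorem lintegral_expKernel {r : ℝ} (hr : 0 < r) : ∫⁻ y, expKernel r y = ENNReal.ofReal r⁻¹ := by
  simp only [expKernel]
  rw [lintegral_indicator measurableSet_Ici, ← restrict_Ioi_eq_restrict_Ici, lintegral_exp_Ioi hr]

theorem enorm_cexp_neg_mul (μ : ℂ) (x : ℝ) :
    ‖Complex.exp (-μ * x)‖ₑ = ENNReal.ofReal (Real.exp (-μ.re * x)) := by
  rw [← ofReal_norm, Complex.norm_exp]
  simp

/-- `‖e^{-μ x}‖ = (2 Re μ)^{-1/2}` in `L²(0, ∞)`. -/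
theorem eLpNorm_cexp_neg_mul {μ : ℂ} (hμ : 0 < μ.re) :
    eLpNorm (fun x : ℝ => Complex.exp (-μ * x)) 2 (volume.restrict (Ioi 0))
      = ENNReal.ofReal (Real.sqrt (2 * μ.re))⁻¹ := by
  have h : eLpNorm (fun x : ℝ => Complex.exp (-μ * x)) 2 (volume.restrict (Ioi 0)) ^ 2
      = ENNReal.ofReal (Real.sqrt (2 * μ.re))⁻¹ ^ 2 := by
    rw [eLpNorm_two_sq, ← ENNReal.ofReal_pow (by positivity), inv_pow,
      Real.sq_sqrt (by positivity), ← lintegral_exp_Ioi (by positivity)]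
    refine lintegral_congr fun x => ?_
    rw [enorm_cexp_neg_mul, ← ENNReal.ofReal_pow (Real.exp_pos _).le, ← Real.exp_nat_mul]
    congr 2
    push_cast
    ring
  exact (ENNReal.pow_right_strictMono two_ne_zero).injective h

theorem norm_toLp_le {Y : ℝ → ℂ} (hY : MemLp Y 2 (volume.restrict (Ω : Set ℝ))) {B : ℝ}
    (hB : 0 ≤ B) (h : eLpNorm Y 2 (volume.restrict (Ω : Set ℝ)) ≤ ENNReal.ofReal B) :
    ‖hY.toLp Y‖ ≤ B := by
  rw [Lp.norm_toLp]
  exact ENNReal.toReal_le_of_le_ofReal hB h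

/-- The initial value problem `w' = - μ w + d`, `w(0) = c`, in `L²(0, ∞)`, with decaying
exponential. -/
theorem exists_heat_forward {μ : ℂ} (hμ : 0 < μ.re) (d : L2 heatInterval) (c : ℂ) :
    ∃ w : L2 heatInterval, IsWeakDeriv w (-μ • w + d) ∧ HasBoundaryValue w 0 c ∧
      ‖w‖ ≤ ‖c‖ * (Real.sqrt (2 * μ.re))⁻¹ + ‖d‖ / μ.re := by
  set D : ℝ → ℂ := (heatInterval : Set ℝ).indicator d with hD
  have hDl : LocallyIntegrable D := locallyIntegrable_indicator d
  set Y : ℝ → ℂ := duhamel (-μ) c 0 D with hYdef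
  have hYc : Continuous Y := continuous_duhamel _ _ _ hDl
  set Z : ℝ → ℂ := duhamel (-μ) 0 0 D with hZdef
  have hZc : Continuous Z := continuous_duhamel _ _ _ hDl
  have hYZ : Y = (fun x : ℝ => c • Complex.exp (-μ * x)) + Z := by
    ext x
    simp only [hYdef, hZdef, duhamel, Pi.add_apply, smul_eq_mul, zero_add]
    ring
  have hZb : eLpNorm Z 2 (volume.restrict (heatInterval : Set ℝ))
      ≤ ENNReal.ofReal μ.re⁻¹ * ‖d‖ₑ := by
    refine eLpNorm_le_of_enorm_le_lintegral (K := fun x t => expKernel μ.re (x - t))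
      ((measurable_expKernel _).comp measurable_sub) (fun x => ?_) (fun t => ?_) d ?_
    · rw [lintegral_sub_left_eq_self (expKernel μ.re), lintegral_expKernel hμ]
    · rw [lintegral_sub_right_eq_self (expKernel μ.re), lintegral_expKernel hμ]
    · intro x hx
      have hx : 0 < x := hx
      have e : Z x = ∫ t in Ioc 0 x, Complex.exp (-μ * ((x - t : ℝ) : ℂ)) * D t := by
        simp only [hZdef, duhamel, zero_add]
        rw [intervalIntegral.integral_of_le hx.le, ← integral_const_mul]
        refine integral_congr_ae (Eventually.of_forall fun t => ?_)
        simp only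
        rw [← mul_assoc, ← Complex.exp_add]
        congr 2
        push_cast
        ring
      rw [e]
      refine (enorm_integral_le_lintegral_enorm _).trans ?_
      rw [← lintegral_indicator measurableSet_Ioc]
      refine lintegral_mono fun t => ?_
      by_cases ht : t ∈ Ioc 0 x
      · rw [indicator_of_mem ht, enorm_mul, enorm_cexp_neg_mul, expKernel,
          indicator_of_mem (show x - t ∈ Ici 0 from sub_nonneg.2 ht.2)]
      · rw [indicator_of_notMem ht]
        exact zero_le
  have hYb : eLpNorm Y 2 (volume.restrict (heatInterval : Set ℝ))
      ≤ ENNReal.ofReal (‖c‖ * (Real.sqrt (2 * μ.re))⁻¹ + ‖d‖ / μ.re) := by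
    rw [hYZ]
    refine (eLpNorm_add_le ?_ hZc.aestronglyMeasurable (by norm_num)).trans ?_
    · exact ((contDiff_cexp_mul (-μ) (n := 1)).continuous.const_smul c).aestronglyMeasurable
    rw [ENNReal.ofReal_add (by positivity) (by positivity)]
    refine add_le_add ?_ (hZb.trans ?_)
    · refine (eLpNorm_const_smul_le (c := c)
        (f := fun x : ℝ => Complex.exp (-μ * x))).trans ?_
      rw [show ((heatInterval : Set ℝ)) = Ioi 0 from rfl, eLpNorm_cexp_neg_mul hμ,
        ENNReal.ofReal_mul (norm_nonneg _), ofReal_norm]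
    · rw [← ofReal_norm, ← ENNReal.ofReal_mul (by positivity), div_eq_inv_mul]
  have hYm : MemLp Y 2 (volume.restrict (heatInterval : Set ℝ)) :=
    ⟨hYc.aestronglyMeasurable, hYb.trans_lt ENNReal.ofReal_lt_top⟩
  refine ⟨hYm.toLp Y, isWeakDeriv_of_ae_eq_duhamel hYm.coeFn_toLp, ?_,
    norm_toLp_le hYm (by positivity) hYb⟩
  have := hasBoundaryValue_of_ae_eq hYc hYm.coeFn_toLp 0
  simpa [hYdef, duhamel] using this

/-- The equation `d' = μ d + k` in `L²(0, ∞)`, with growing exponential: the solution is obtained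
by integrating from `∞`, so its boundary value `H` cannot be prescribed. -/
theorem exists_heat_backward {μ : ℂ} (hμ : 0 < μ.re) (k : L2 heatInterval) :
    ∃ (d : L2 heatInterval) (H : ℂ), IsWeakDeriv d (μ • d + k) ∧ HasBoundaryValue d 0 H ∧
      ‖H‖ ≤ (Real.sqrt (2 * μ.re))⁻¹ * ‖k‖ ∧ ‖d‖ ≤ ‖k‖ / μ.re := by
  set D : ℝ → ℂ := (heatInterval : Set ℝ).indicator k with hD
  have hDl : LocallyIntegrable D := locallyIntegrable_indicator k
  have hEc : Continuous fun x : ℝ => Complex.exp (-μ * x) :=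
    (contDiff_cexp_mul (-μ) (n := 1)).continuous
  have hDk : D =ᵐ[volume.restrict (Ioi 0)] k := by
    filter_upwards [ae_restrict_mem measurableSet_Ioi] with x hx
    rw [hD, indicator_of_mem (show x ∈ (heatInterval : Set ℝ) from hx)]
  have hDm : eLpNorm D 2 (volume.restrict (Ioi 0)) = ‖k‖ₑ := by
    rw [eLpNorm_congr_ae hDk, Lp.enorm_def]
    rfl
  have hDs : AEStronglyMeasurable D (volume.restrict (Ioi 0)) :=
    (Lp.aestronglyMeasurable k).congr hDk.symm
  have hL1 : eLpNorm (fun t : ℝ => Complex.exp (-μ * t) * D t) 1 (volume.restrict (Ioi 0))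
      ≤ ENNReal.ofReal ((Real.sqrt (2 * μ.re))⁻¹ * ‖k‖) := by
    refine (eLpNorm_smul_le_mul_eLpNorm (p := 2) (q := 2) hDs hEc.aestronglyMeasurable).trans ?_
    rw [eLpNorm_cexp_neg_mul hμ, hDm, ENNReal.ofReal_mul (by positivity), ofReal_norm]
  have hI : IntegrableOn (fun t : ℝ => Complex.exp (-μ * t) * D t) (Ioi 0) :=
    memLp_one_iff_integrable.1
      ⟨hEc.aestronglyMeasurable.mul hDs, hL1.trans_lt ENNReal.ofReal_lt_top⟩
  set H : ℂ := -∫ t : ℝ in Ioi 0, Complex.exp (-μ * t) * D t with hH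
  -- this choice of `H` cancels the growing exponential: `d(x) = - ∫_x^∞ e^{-μ (t - x)} k(t) dt`
  set Y : ℝ → ℂ := duhamel μ H 0 D with hYdef
  have hYc : Continuous Y := continuous_duhamel _ _ _ hDl
  have hYb : eLpNorm Y 2 (volume.restrict (heatInterval : Set ℝ))
      ≤ ENNReal.ofReal μ.re⁻¹ * ‖k‖ₑ := by
    refine eLpNorm_le_of_enorm_le_lintegral (K := fun x t => expKernel μ.re (t - x))
      ((measurable_expKernel _).comp (measurable_snd.sub measurable_fst)) (fun x => ?_)
      (fun t => ?_) k ?_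
    · rw [lintegral_sub_right_eq_self (expKernel μ.re), lintegral_expKernel hμ]
    · rw [lintegral_sub_left_eq_self (expKernel μ.re), lintegral_expKernel hμ]
    · intro x hx
      have hx : 0 < x := hx
      have e : Y x = -∫ t in Ioi x, Complex.exp (-μ * ((t - x : ℝ) : ℂ)) * D t := by
        have hs := intervalIntegral.integral_interval_add_Ioi hI
          (hI.mono_set (Ioi_subset_Ioi hx.le))
        simp only [hYdef, duhamel, hH]
        rw [← hs, neg_add_rev, neg_add_cancel_right, mul_neg, ← integral_const_mul]
        congr 1
        refine integral_congr_ae (Eventually.of_forall fun t => ?_)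
        simp only
        rw [← mul_assoc, ← Complex.exp_add]
        congr 2
        push_cast
        ring
      rw [e, enorm_neg]
      refine (enorm_integral_le_lintegral_enorm _).trans ?_
      rw [← lintegral_indicator measurableSet_Ioi]
      refine lintegral_mono fun t => ?_
      by_cases ht : t ∈ Ioi x
      · rw [indicator_of_mem ht, enorm_mul, enorm_cexp_neg_mul, expKernel,
          indicator_of_mem (show t - x ∈ Ici 0 from sub_nonneg.2 (mem_Ioi.1 ht).le)]
      · rw [indicator_of_notMem ht]
        exact zero_le
  have hYb' : eLpNorm Y 2 (volume.restrict (heatInterval : Set ℝ))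
      ≤ ENNReal.ofReal (‖k‖ / μ.re) := by
    refine hYb.trans_eq ?_
    rw [← ofReal_norm, ← ENNReal.ofReal_mul (by positivity), div_eq_inv_mul]
  have hYm : MemLp Y 2 (volume.restrict (heatInterval : Set ℝ)) :=
    ⟨hYc.aestronglyMeasurable, hYb'.trans_lt ENNReal.ofReal_lt_top⟩
  refine ⟨hYm.toLp Y, H, isWeakDeriv_of_ae_eq_duhamel hYm.coeFn_toLp, ?_, ?_,
    norm_toLp_le hYm (by positivity) hYb'⟩
  · have := hasBoundaryValue_of_ae_eq hYc hYm.coeFn_toLp 0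
    simpa [hYdef, duhamel] using this
  · rw [hH, norm_neg]
    have h1 := (enorm_integral_le_lintegral_enorm
      (μ := volume.restrict (Ioi (0 : ℝ))) fun t : ℝ => Complex.exp (-μ * t) * D t)
    rw [← eLpNorm_one_eq_lintegral_enorm] at h1
    rw [← ENNReal.ofReal_le_ofReal_iff (by positivity), ofReal_norm]
    exact h1.trans hL1

/-! ### The transport equations on the bounded interval -/

/-- `u' = κ u + k` on `(-1, 0)` with `u(-1) = c`, for imaginary `κ`; the right boundary value is
affine in `c`. -/
theorem exists_wave_transport {κ : ℂ} (hκ : κ.re = 0) (k : L2 waveInterval) :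
    ∃ J : ℂ, ‖J‖ ≤ ‖k‖ ∧ ∀ c : ℂ, ∃ u : L2 waveInterval, IsWeakDeriv u (κ • u + k) ∧
      HasBoundaryValue u (-1) c ∧ HasBoundaryValue u 0 (Complex.exp κ * c + J) ∧
      ‖u‖ ≤ ‖c‖ + ‖k‖ := by
  set D : ℝ → ℂ := (waveInterval : Set ℝ).indicator k with hD
  have hDl : LocallyIntegrable D := locallyIntegrable_indicator k
  have hprob : IsProbabilityMeasure (volume.restrict (waveInterval : Set ℝ)) :=
    ⟨by simp [waveInterval]⟩
  have hDk : D =ᵐ[volume.restrict (waveInterval : Set ℝ)] k := by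
    filter_upwards [ae_restrict_mem waveInterval.isOpen.measurableSet] with x hx
    rw [hD, indicator_of_mem hx]
  have hexp : ∀ x : ℝ, ‖Complex.exp (κ * x)‖ = 1 := fun x => by
    rw [Complex.norm_exp]
    simp [hκ]
  have hexp' : ∀ x : ℝ, ‖Complex.exp (-κ * x)‖ = 1 := fun x => by
    rw [Complex.norm_exp]
    simp [hκ]
  have hL1 : ∫⁻ t, ‖D t‖ₑ ≤ ENNReal.ofReal ‖k‖ := by
    have : (fun t => ‖D t‖ₑ) = (waveInterval : Set ℝ).indicator fun t => ‖k t‖ₑ := by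
      ext t
      rw [hD, enorm_indicator_eq_indicator_enorm]
    rw [this, lintegral_indicator waveInterval.isOpen.measurableSet,
      ← eLpNorm_one_eq_lintegral_enorm, ofReal_norm, Lp.enorm_def]
    exact eLpNorm_le_eLpNorm_of_exponent_le (by norm_num) (Lp.aestronglyMeasurable k)
  have hint : ∀ x, -1 ≤ x → ‖∫ t in (-1 : ℝ)..x, Complex.exp (-κ * t) * D t‖ ≤ ‖k‖ := by
    intro x hx
    rw [← ENNReal.ofReal_le_ofReal_iff (norm_nonneg _), ofReal_norm,
      intervalIntegral.integral_of_le hx]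
    refine (enorm_integral_le_lintegral_enorm _).trans ((setLIntegral_le_lintegral _ _).trans
      (le_trans (lintegral_mono fun t => ?_) hL1))
    rw [enorm_mul, ← ofReal_norm (Complex.exp _), hexp']
    simp
  refine ⟨∫ t in (-1 : ℝ)..0, Complex.exp (-κ * t) * D t, hint 0 (by norm_num), fun c => ?_⟩
  -- the factor `e^κ` moves the initial condition from `0` to `-1`
  set Y : ℝ → ℂ := duhamel κ (Complex.exp κ * c) (-1) D with hYdef
  have hYc : Continuous Y := continuous_duhamel _ _ _ hDl
  have hYb : ∀ᵐ x ∂volume.restrict (waveInterval : Set ℝ), ‖Y x‖ ≤ ‖c‖ + ‖k‖ := by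
    filter_upwards [ae_restrict_mem waveInterval.isOpen.measurableSet] with x hx
    have hx : x ∈ Ioo (-1 : ℝ) 0 := hx
    simp only [hYdef, duhamel]
    rw [norm_mul, hexp, one_mul]
    refine (norm_add_le _ _).trans (add_le_add ?_ (hint x hx.1.le))
    rw [norm_mul, show Complex.exp κ = Complex.exp (κ * (1 : ℝ)) by simp, hexp, one_mul]
  have hYn : eLpNorm Y 2 (volume.restrict (waveInterval : Set ℝ))
      ≤ ENNReal.ofReal (‖c‖ + ‖k‖) := by
    refine (eLpNorm_le_of_ae_bound hYb).trans_eq ?_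
    rw [measure_univ, ENNReal.one_rpow, one_mul]
  have hYm : MemLp Y 2 (volume.restrict (waveInterval : Set ℝ)) :=
    ⟨hYc.aestronglyMeasurable, hYn.trans_lt ENNReal.ofReal_lt_top⟩
  refine ⟨hYm.toLp Y, isWeakDeriv_of_ae_eq_duhamel hYm.coeFn_toLp, ?_, ?_,
    norm_toLp_le hYm (by positivity) hYn⟩
  · have := hasBoundaryValue_of_ae_eq hYc hYm.coeFn_toLp (-1)
    have e : Y (-1) = c := by
      simp only [hYdef, duhamel, intervalIntegral.integral_same, add_zero]
      rw [← mul_assoc, ← Complex.exp_add]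
      simp
    rwa [e] at this
  · have := hasBoundaryValue_of_ae_eq hYc hYm.coeFn_toLp 0
    have e : Y 0 = Complex.exp κ * c + ∫ t in (-1 : ℝ)..0, Complex.exp (-κ * t) * D t := by
      simp only [hYdef, duhamel]
      simp
    rwa [e] at this

/-! ### The resolvent equation -/

theorem IsWeakDeriv.mem_sobolevH1 {u g : L2 Ω} (h : IsWeakDeriv u g) : u ∈ sobolevH1 Ω := ⟨g, h⟩

theorem IsWeakDeriv.weakDeriv_eq {u g : L2 Ω} (h : IsWeakDeriv u g) : weakDeriv u = g :=
  (isWeakDeriv_weakDeriv h.mem_sobolevH1).unique h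

theorem IsWeakDeriv.mem_sobolevH2 {u g k : L2 Ω} (h : IsWeakDeriv u g) (h' : IsWeakDeriv g k) :
    u ∈ sobolevH2 Ω :=
  ⟨h.mem_sobolevH1, by rw [h.weakDeriv_eq]; exact h'.mem_sobolevH1⟩

theorem StateSpace.norm_le_add (x : StateSpace) :
    ‖x‖ ≤ ‖weakDeriv x.u‖ + ‖x.v‖ + ‖x.w‖ := by
  refine le_of_sq_le_sq ?_ (by positivity)
  rw [x.norm_sq]
  nlinarith [norm_nonneg (weakDeriv x.u), norm_nonneg x.v, norm_nonneg x.w,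
    mul_nonneg (norm_nonneg (weakDeriv x.u)) (norm_nonneg x.v),
    mul_nonneg (norm_nonneg (weakDeriv x.u)) (norm_nonneg x.w),
    mul_nonneg (norm_nonneg x.v) (norm_nonneg x.w)]

theorem StateSpace.norm_weakDeriv_u_le (x : StateSpace) : ‖weakDeriv x.u‖ ≤ ‖x‖ := by
  refine le_of_sq_le_sq ?_ (norm_nonneg _)
  nlinarith [x.norm_sq, sq_nonneg ‖x.v‖, sq_nonneg ‖x.w‖]

theorem StateSpace.norm_v_le (x : StateSpace) : ‖x.v‖ ≤ ‖x‖ := by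
  refine le_of_sq_le_sq ?_ (norm_nonneg _)
  nlinarith [x.norm_sq, sq_nonneg ‖weakDeriv x.u‖, sq_nonneg ‖x.w‖]

theorem StateSpace.norm_w_le (x : StateSpace) : ‖x.w‖ ≤ ‖x‖ := by
  refine le_of_sq_le_sq ?_ (norm_nonneg _)
  nlinarith [x.norm_sq, sq_nonneg ‖weakDeriv x.u‖, sq_nonneg ‖x.v‖]

theorem norm_cexp_of_re_eq_zero {κ : ℂ} (hκ : κ.re = 0) : ‖Complex.exp κ‖ = 1 := by
  rw [Complex.norm_exp, hκ, Real.exp_zero]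

/-- The characteristic function of the coupled problem at spectral parameter `μ²`, equal to
`2 (cosh μ² + μ sinh μ²)`. Up to a constant factor it is the determinant of the conditions
`v(-1) = 0` and `u'(0) + μ v(0) = 0` on the solutions `v + u' = a e^{μ² x}`,
`v - u' = b e^{-μ² x}` of the homogeneous wave equation. -/
def charFun (μ : ℂ) : ℂ := (1 + μ) * Complex.exp (μ ^ 2) + (1 - μ) * Complex.exp (-μ ^ 2)

/-- Solvability of `(μ² - A) x = y` with a bound on the solution. The unknowns are
`a = v + u'`, `b = v - u'` and `d = w' + μ w`, each of which solves a first-order equation. -/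
theorem exists_solution {μ : ℂ} (hμ : 0 < μ.re) (hμ2 : (μ ^ 2).re = 0)
    (hD : 1 / 2 ≤ ‖charFun μ‖) (y : StateSpace) :
    ∃ x : generator.domain, μ ^ 2 • (x : StateSpace) - generator x = y ∧
      ‖(x : StateSpace)‖ ≤ ((4 * (Real.sqrt (2 * μ.re))⁻¹ + 10 + 8 * ‖μ‖)
        * (2 + (Real.sqrt (2 * μ.re))⁻¹) + μ.re⁻¹ ^ 2) * ‖y‖ := by
  set q : ℝ := (Real.sqrt (2 * μ.re))⁻¹ with hq
  have hq0 : 0 ≤ q := by positivity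
  set z : ℂ := μ ^ 2 with hz
  have hz0 : z ≠ 0 := pow_ne_zero 2 fun h => by simp [h] at hμ
  have hnz : (-z).re = 0 := by rw [Complex.neg_re, hμ2, neg_zero]
  set N : ℝ := ‖y‖ with hN
  set F : L2 waveInterval := weakDeriv y.u with hF
  have hFy : IsWeakDeriv y.u F := isWeakDeriv_weakDeriv y.u_mem
  have nF : ‖F‖ ≤ N := y.norm_weakDeriv_u_le
  have ng : ‖y.v‖ ≤ N := y.norm_v_le
  have nh : ‖y.w‖ ≤ N := y.norm_w_le
  have nkA : ‖-(y.v + F)‖ ≤ 2 * N := by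
    rw [norm_neg]
    exact (norm_add_le _ _).trans (by linarith)
  have nkB : ‖y.v - F‖ ≤ 2 * N := (norm_sub_le _ _).trans (by linarith)
  -- `d = w' + μ w` satisfies `d' = μ d - h`, whence `w'(0) + μ w(0) = H`
  obtain ⟨d, H, hd, hdH, nH, nd⟩ := exists_heat_backward hμ (-y.w)
  rw [norm_neg] at nH nd
  obtain ⟨JA, nJA, hA⟩ := exists_wave_transport hμ2 (-(y.v + F))
  obtain ⟨JB, nJB, hB⟩ := exists_wave_transport hnz (y.v - F)
  -- the value of `v + u'` at `-1` for which the transmission conditions at `0` hold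
  set c : ℂ := (2 * H - (1 + μ) * JA - (μ - 1) * JB) / charFun μ with hc
  have hD0 : charFun μ ≠ 0 := fun h => by
    rw [h, norm_zero] at hD
    norm_num at hD
  have hcD : c * charFun μ = 2 * H - (1 + μ) * JA - (μ - 1) * JB := div_mul_cancel₀ _ hD0
  have nc : ‖c‖ ≤ (4 * q + 8 + 8 * ‖μ‖) * N := by
    have h1 : ‖c‖ * ‖charFun μ‖ ≤ 2 * (q * N) + (1 + ‖μ‖) * (2 * N) + (‖μ‖ + 1) * (2 * N) := by
      rw [← norm_mul, hcD]
      refine (norm_sub_le _ _).trans (add_le_add ((norm_sub_le _ _).trans (add_le_add ?_ ?_)) ?_)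
      · rw [norm_mul, Complex.norm_ofNat]
        gcongr
        exact nH.trans (by gcongr)
      · rw [norm_mul]
        gcongr
        · exact (norm_add_le _ _).trans (by rw [norm_one])
        · exact nJA.trans nkA
      · rw [norm_mul]
        gcongr
        · exact (norm_sub_le _ _).trans (by rw [norm_one])
        · exact nJB.trans nkB
    have h2 : ‖c‖ * (1 / 2) ≤ ‖c‖ * ‖charFun μ‖ := by gcongr
    linarith
  set S : ℝ := (4 * q + 10 + 8 * ‖μ‖) * N with hS
  have hcS : ‖c‖ + 2 * N ≤ S := by
    rw [hS]
    linarith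
  obtain ⟨a, ha, haL, haR, na⟩ := hA c
  obtain ⟨b, hb, hbL, hbR, nb⟩ := hB (-c)
  rw [norm_neg] at nb
  -- `v` is the velocity and `p` the strain `u'`
  set v : L2 waveInterval := (1 / 2 : ℂ) • (a + b) with hv
  set p : L2 waveInterval := (1 / 2 : ℂ) • (a + (-1 : ℂ) • b) with hp
  have nv : ‖v‖ ≤ S := by
    rw [hv, norm_smul]
    have := norm_add_le a b
    norm_num
    linarith
  have np : ‖p‖ ≤ S := by
    rw [hp, norm_smul]
    have := norm_add_le a ((-1 : ℂ) • b)
    rw [norm_smul, norm_neg, norm_one, one_mul] at this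
    norm_num at this ⊢
    linarith
  have dv : IsWeakDeriv v (z • p + -F) := by
    convert (ha.add hb).smul (1 / 2 : ℂ) using 1
    rw [hp]
    module
  have dp : IsWeakDeriv p (z • v + -y.v) := by
    convert (ha.add (hb.smul (-1))).smul (1 / 2 : ℂ) using 1
    rw [hv]
    module
  have vL : HasBoundaryValue v (-1) 0 := by
    convert (haL.add hbL).smul (1 / 2 : ℂ) using 1
    ring
  have vR := (haR.add hbR).smul (1 / 2 : ℂ)
  have pR := (haR.add (hbR.smul (-1))).smul (1 / 2 : ℂ)
  rw [← hv] at vR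
  rw [← hp] at pR
  set W : ℂ := 1 / 2 * (Complex.exp z * c + JA + (Complex.exp (-z) * -c + JB)) with hW
  have nW : ‖W‖ ≤ S := by
    have e1 := norm_cexp_of_re_eq_zero hμ2
    have e2 := norm_cexp_of_re_eq_zero hnz
    have h1 := norm_add_le (Complex.exp z * c + JA) (Complex.exp (-z) * -c + JB)
    have h2 := norm_add_le (Complex.exp z * c) JA
    have h3 := norm_add_le (Complex.exp (-z) * -c) JB
    rw [norm_mul, e1] at h2
    rw [norm_mul, e2, norm_neg] at h3
    rw [hW, norm_mul, show ‖(1 / 2 : ℂ)‖ = 1 / 2 by norm_num]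
    linarith
  obtain ⟨w, hw, hwW, nw⟩ := exists_heat_forward hμ d W
  have hwd : IsWeakDeriv (-μ • w + d) (z • w + -y.w) := by
    convert (hw.smul (-μ)).add hd using 1
    rw [hz]
    module
  have hdu : IsWeakDeriv (z⁻¹ • (v + y.u)) p := by
    convert (dv.add hFy).smul z⁻¹ using 1
    rw [neg_add_cancel_right, smul_smul, inv_mul_cancel₀ hz0, one_smul]
  -- `u` is read off from `z u - v = f`; its derivative is then automatically `p`
  let x : StateSpace := StateSpace.mk (z⁻¹ • (v + y.u)) v w hdu.mem_sobolevH1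
    (by simpa using (vL.add y.u_left).smul z⁻¹)
  have hx : x ∈ generatorDomain := by
    refine ⟨⟨hdu.mem_sobolevH2 dp, dv.mem_sobolevH1, hw.mem_sobolevH2 hwd⟩, vL,
      ⟨-μ * W + H, ?_, ?_⟩, W, vR, hwW⟩
    · change HasBoundaryValue (weakDeriv (z⁻¹ • (v + y.u))) 0 _
      rw [hdu.weakDeriv_eq]
      convert pR using 1
      rw [charFun, ← hz] at hcD
      rw [hW]
      linear_combination (-1 / 2) * hcD
    · change HasBoundaryValue (weakDeriv w) 0 _
      rw [hw.weakDeriv_eq]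
      exact (hwW.smul (-μ)).add hdH
  refine ⟨⟨x, hx⟩, StateSpace.ext ?_ ?_ ?_, ?_⟩
  · change z • (z⁻¹ • (v + y.u)) - v = y.u
    rw [smul_smul, mul_inv_cancel₀ hz0, one_smul, add_sub_cancel_left]
  · change z • v - weakDeriv (weakDeriv (z⁻¹ • (v + y.u))) = y.v
    rw [hdu.weakDeriv_eq, dp.weakDeriv_eq]
    abel
  · change z • w - weakDeriv (weakDeriv w) = y.w
    rw [hw.weakDeriv_eq, hwd.weakDeriv_eq]
    abel
  · have h1 := x.norm_le_add
    change ‖x‖ ≤ ‖weakDeriv (z⁻¹ • (v + y.u))‖ + ‖v‖ + ‖w‖ at h1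
    rw [hdu.weakDeriv_eq] at h1
    have h2 : ‖W‖ * q ≤ S * q := by gcongr
    have h3 : ‖d‖ / μ.re ≤ μ.re⁻¹ ^ 2 * N := by
      have : ‖d‖ / μ.re ≤ (N / μ.re) / μ.re := by
        gcongr
        exact nd.trans (by gcongr)
      refine this.trans_eq ?_
      field_simp
    change ‖x‖ ≤ _
    calc ‖x‖ ≤ S + S + (S * q + μ.re⁻¹ ^ 2 * N) := by linarith
      _ = _ := by rw [hS]; ring

/-- Injectivity of `μ² - A`: in the homogeneous problem `v ± u'` and `w` are exponentials, and
the boundary and transmission conditions reduce to `v(0) * charFun μ = 0`. -/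
theorem eq_zero_of_generator_eq {μ : ℂ} (hμ : 0 < μ.re) (hD : charFun μ ≠ 0)
    (x : generator.domain) (hx : μ ^ 2 • (x : StateSpace) - generator x = 0) :
    (x : StateSpace) = 0 := by
  obtain ⟨x, ⟨⟨hu1, hu2⟩, hv1, hw1, hw2⟩, hvL, ⟨P, huP, hwP⟩, V, hvV, hwV⟩ := x
  set z : ℂ := μ ^ 2 with hz
  have hz0 : z ≠ 0 := pow_ne_zero 2 fun h => by simp [h] at hμ
  have e1 : z • x.u - x.v = 0 := congrArg StateSpace.u hx
  have e2 : z • x.v - weakDeriv (weakDeriv x.u) = 0 := congrArg StateSpace.v hx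
  have e3 : z • x.w - weakDeriv (weakDeriv x.w) = 0 := congrArg StateSpace.w hx
  have e1' : x.v = z • x.u := (sub_eq_zero.1 e1).symm
  have dp := isWeakDeriv_weakDeriv hu2
  rw [← sub_eq_zero.1 e2] at dp
  have dv : IsWeakDeriv x.v (z • weakDeriv x.u) := by
    rw [e1']
    exact (isWeakDeriv_weakDeriv hu1).smul z
  have dw := isWeakDeriv_weakDeriv hw1
  have dw' := isWeakDeriv_weakDeriv hw2
  rw [← sub_eq_zero.1 e3] at dw'
  have oW : (waveInterval : Set ℝ).OrdConnected := ordConnected_Ioo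
  have neW : (waveInterval : Set ℝ).Nonempty := nonempty_Ioo.2 (by norm_num)
  have oH : (heatInterval : Set ℝ).OrdConnected := ordConnected_Ioi
  have neH : (heatInterval : Set ℝ).Nonempty := nonempty_Ioi
  have m0 : (0 : ℝ) ∈ closure (waveInterval : Set ℝ) := by
    rw [closure_waveInterval]
    norm_num
  have m1 : (-1 : ℝ) ∈ closure (waveInterval : Set ℝ) := by
    rw [closure_waveInterval]
    norm_num
  have m0' : (0 : ℝ) ∈ closure (heatInterval : Set ℝ) := by
    rw [closure_heatInterval]
    norm_num
  have ec (κ c : ℂ) : Continuous fun x : ℝ => c * Complex.exp (κ * x) :=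
    continuous_const.mul (contDiff_cexp_mul κ (n := 1)).continuous
  obtain ⟨A, hA⟩ := ae_eq_exp_of_isWeakDeriv oW neW (u := x.v + weakDeriv x.u) (κ := z) (by
    convert dv.add dp using 1
    module)
  obtain ⟨B, hB⟩ := ae_eq_exp_of_isWeakDeriv oW neW (u := x.v + (-1 : ℂ) • weakDeriv x.u)
    (κ := -z) (by
      convert dv.add (dp.smul (-1)) using 1
      module)
  obtain ⟨C, hC⟩ := ae_eq_exp_of_isWeakDeriv oH neH (u := weakDeriv x.w + μ • x.w) (κ := μ) (by
    convert dw'.add (dw.smul μ) using 1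
    rw [hz]
    module)
  -- a nonzero multiple of the growing exponential is not square integrable
  have hC0 : C = 0 := by
    have hm : MemLp (fun _ : ℝ => C) 2 (volume.restrict (heatInterval : Set ℝ)) := by
      refine (Lp.memLp (weakDeriv x.w + μ • x.w)).mono aestronglyMeasurable_const ?_
      filter_upwards [hC, ae_restrict_mem heatInterval.isOpen.measurableSet] with t ht h0
      have h0 : 0 < t := h0
      rw [ht, norm_mul, Complex.norm_exp]
      refine le_mul_of_one_le_right (norm_nonneg _) (Real.one_le_exp ?_)
      simp only [Complex.mul_re, Complex.ofReal_re, Complex.ofReal_im, mul_zero, sub_zero]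
      positivity
    rcases (memLp_const_iff two_ne_zero ENNReal.ofNat_ne_top).1 hm with h | h
    · exact h
    · simp [heatInterval] at h
  have hd0 : weakDeriv x.w + μ • x.w = 0 := by
    rw [Lp.eq_zero_iff_ae_eq_zero]
    filter_upwards [hC] with t ht
    rw [ht, hC0, zero_mul, Pi.zero_apply]
  have hwd : weakDeriv x.w = -μ • x.w := by
    rw [neg_smul]
    exact eq_neg_of_add_eq_zero_left hd0
  rw [hwd] at dw hwP
  obtain ⟨K, hK⟩ := ae_eq_exp_of_isWeakDeriv oH neH dw
  -- the boundary conditions as linear equations for the remaining constants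
  have b1 := (hvV.add huP).unique m0 (hasBoundaryValue_of_ae_eq (ec _ _) hA 0)
  have b2 := (hvV.add (huP.smul (-1))).unique m0 (hasBoundaryValue_of_ae_eq (ec _ _) hB 0)
  have b3 : P = -μ * V := hwP.unique m0' (hwV.smul (-μ))
  have b4 := (((hasBoundaryValue_of_ae_eq (ec _ _) hA (-1)).add
    (hasBoundaryValue_of_ae_eq (ec _ _) hB (-1))).smul (1 / 2 : ℂ))
  have ev : (1 / 2 : ℂ) • ((x.v + weakDeriv x.u) + (x.v + (-1 : ℂ) • weakDeriv x.u)) = x.v := by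
    module
  rw [ev] at b4
  have b4 := hvL.unique m1 b4
  have b5 := hwV.unique m0' (hasBoundaryValue_of_ae_eq (ec _ _) hK 0)
  simp only [Complex.ofReal_zero, mul_zero, Complex.exp_zero, mul_one] at b1 b2 b5
  simp only [Complex.ofReal_neg, Complex.ofReal_one, mul_neg, mul_one, neg_neg] at b4
  have hexp : Complex.exp z * Complex.exp (-z) = 1 := by
    rw [← Complex.exp_add, add_neg_cancel, Complex.exp_zero]
  have hV : V = 0 := by
    have hVD : V * charFun μ = 0 := by
      rw [charFun, ← hz]
      linear_combination (-2) * b4 + Complex.exp (-z) * b1 + Complex.exp z * b2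
        + (Complex.exp z - Complex.exp (-z)) * b3
    exact (mul_eq_zero.1 hVD).resolve_right hD
  have hA0 : A = 0 := by
    rw [← b1, b3, hV]
    ring
  have hB0 : B = 0 := by
    rw [← b2, b3, hV]
    ring
  have zA : x.v + weakDeriv x.u = 0 := by
    rw [Lp.eq_zero_iff_ae_eq_zero]
    filter_upwards [hA] with t ht
    rw [ht, hA0, zero_mul, Pi.zero_apply]
  have zB : x.v + (-1 : ℂ) • weakDeriv x.u = 0 := by
    rw [Lp.eq_zero_iff_ae_eq_zero]
    filter_upwards [hB] with t ht
    rw [ht, hB0, zero_mul, Pi.zero_apply]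
  have zv : x.v = 0 := by
    rw [← ev, zA, zB, add_zero, smul_zero]
  have zw : x.w = 0 := by
    rw [Lp.eq_zero_iff_ae_eq_zero]
    filter_upwards [hK] with t ht
    rw [ht, ← b5, hV, zero_mul, Pi.zero_apply]
  have zu : x.u = 0 := by
    rw [zv] at e1'
    exact (smul_eq_zero.1 e1'.symm).resolve_left hz0
  exact StateSpace.ext zu zv zw

/-! ### Resolvent bounds -/

/-- Unique solvability with the a priori bound `‖x‖ ≤ C ‖y‖` gives the resolvent and
`‖R‖ ≤ C`. -/
theorem exists_isResolventAt {E : Type*} [NormedAddCommGroup E] [NormedSpace ℂ E]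
    {A : E →ₗ.[ℂ] E} {z : ℂ} {C : ℝ} (hC : 0 ≤ C)
    (hsurj : ∀ y : E, ∃ x : A.domain, z • (x : E) - A x = y ∧ ‖(x : E)‖ ≤ C * ‖y‖)
    (hinj : ∀ x : A.domain, z • (x : E) - A x = 0 → (x : E) = 0) :
    ∃ R : E →L[ℂ] E, IsResolventAt A z R ∧ ‖R‖ ≤ C := by
  let T : A.domain →ₗ[ℂ] E := z • A.domain.subtype - A.toFun
  have hT : ∀ x, T x = z • (x : E) - A x := fun _ => rfl
  have hTi : Function.Injective T := by
    rw [injective_iff_map_eq_zero]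
    exact fun x hx => Subtype.ext (hinj x hx)
  have hTs : Function.Surjective T := fun y => (hsurj y).imp fun x hx => hx.1
  let e : A.domain ≃ₗ[ℂ] E := LinearEquiv.ofBijective T ⟨hTi, hTs⟩
  have hb : ∀ y : E, ‖(A.domain.subtype.comp e.symm.toLinearMap) y‖ ≤ C * ‖y‖ := by
    intro y
    obtain ⟨x, hx, hn⟩ := hsurj y
    have : e.symm y = x := by rw [LinearEquiv.symm_apply_eq]; exact hx.symm
    change ‖((e.symm y : A.domain) : E)‖ ≤ _
    rwa [this]
  refine ⟨LinearMap.mkContinuous _ C hb, ⟨fun y => ⟨(e.symm y).2, ?_⟩, fun x => ?_⟩,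
    LinearMap.mkContinuous_norm_le _ hC hb⟩
  · exact e.apply_symm_apply y
  · exact congrArg Subtype.val (e.symm_apply_apply x)

/-- The characteristic function is bounded below for `μ = r (1 + σ i)`, `σ = ± 1`. With
`s = 2 σ r²` its real and imaginary parts are twice `cos s - σ r sin s` and `r sin s`. These cannot
both be small: for large `r` because `cos s` and `sin s` do not vanish together, for small `r`
because `s` is close to `0`. -/
theorem half_le_norm_charFun {r σ : ℝ} (hσ : σ ^ 2 = 1) :
    1 / 2 ≤ ‖charFun ((r : ℂ) * (1 + σ * Complex.I))‖ := by
  set s : ℝ := 2 * σ * r ^ 2 with hs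
  set μ : ℂ := (r : ℂ) * (1 + σ * Complex.I) with hμ
  have hσ' : (σ : ℂ) ^ 2 = 1 := by exact_mod_cast hσ
  have hμ2 : μ ^ 2 = (s : ℂ) * Complex.I := by
    rw [hμ, hs]
    push_cast
    linear_combination (r : ℂ) ^ 2 * Complex.I ^ 2 * hσ' + (r : ℂ) ^ 2 * Complex.I_sq
  have e1 : Complex.exp (μ ^ 2) = Real.cos s + Real.sin s * Complex.I := by
    rw [hμ2, Complex.exp_mul_I, Complex.ofReal_cos, Complex.ofReal_sin]
  have e2 : Complex.exp (-μ ^ 2) = Real.cos s - Real.sin s * Complex.I := by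
    rw [hμ2, ← neg_mul, Complex.exp_mul_I, Complex.cos_neg, Complex.sin_neg, Complex.ofReal_cos,
      Complex.ofReal_sin]
    ring
  have hval : charFun μ = ((2 * (Real.cos s - σ * (r * Real.sin s)) : ℝ) : ℂ)
      + ((2 * (r * Real.sin s) : ℝ) : ℂ) * Complex.I := by
    rw [charFun, e1, e2, hμ]
    push_cast
    linear_combination 2 * (r : ℂ) * σ * Complex.sin s * Complex.I_sq
  have hn : ‖charFun μ‖ ^ 2
      = 4 * ((Real.cos s - σ * (r * Real.sin s)) ^ 2 + (r * Real.sin s) ^ 2) := by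
    rw [hval, Complex.sq_norm, Complex.normSq_add_mul_I]
    ring
  have hcs := Real.sin_sq_add_cos_sq s
  set Y : ℝ := r * Real.sin s with hY
  set c : ℝ := Real.cos s with hc
  have h1 : c ^ 2 / 2 ≤ (c - σ * Y) ^ 2 + Y ^ 2 := by
    nlinarith [sq_nonneg (c - 2 * (σ * Y)), mul_pow σ Y 2]
  have h2 : Y ^ 2 ≤ (c - σ * Y) ^ 2 + Y ^ 2 := by linarith [sq_nonneg (c - σ * Y)]
  have hQ : 1 / 16 ≤ (c - σ * Y) ^ 2 + Y ^ 2 := by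
    rcases le_total (1 / 2) (r ^ 2) with hr | hr
    · have : 1 / 2 * Real.sin s ^ 2 ≤ Y ^ 2 := by
        rw [hY, mul_pow]
        gcongr
      linarith
    · have hs1 : s ^ 2 ≤ 1 := by
        have : s ^ 2 = 4 * (r ^ 2) ^ 2 := by rw [hs]; linear_combination 4 * r ^ 4 * hσ
        nlinarith [sq_nonneg r]
      have hc1 : 1 - s ^ 2 / 2 ≤ c := Real.one_sub_sq_div_two_le_cos
      nlinarith
  refine le_of_sq_le_sq ?_ (norm_nonneg _)
  rw [hn]
  linarith

/-- The resolvent bound at `i s = μ²` with `μ = r (1 + σ i)`, `σ = ± 1`, so that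
`|s| = 2 r²`. -/
theorem exists_resolvent_bound {r σ : ℝ} (hr : 0 < r) (hσ : σ ^ 2 = 1) :
    ∃ R : StateSpace →L[ℂ] StateSpace,
      IsResolventAt generator (((2 * σ * r ^ 2 : ℝ) : ℂ) * Complex.I) R ∧
      ‖R‖ ≤ 200 * (r + r⁻¹ ^ 2) := by
  set μ : ℂ := (r : ℂ) * (1 + σ * Complex.I) with hμ
  have hσ' : (σ : ℂ) ^ 2 = 1 := by exact_mod_cast hσ
  have hμ2 : μ ^ 2 = ((2 * σ * r ^ 2 : ℝ) : ℂ) * Complex.I := by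
    rw [hμ]
    push_cast
    linear_combination (r : ℂ) ^ 2 * Complex.I ^ 2 * hσ' + (r : ℂ) ^ 2 * Complex.I_sq
  have hre : μ.re = r := by simp [hμ]
  have hre0 : 0 < μ.re := by rwa [hre]
  have hμ2re : (μ ^ 2).re = 0 := by
    rw [hμ2]
    simp only [Complex.mul_re, Complex.ofReal_re, Complex.ofReal_im, Complex.I_re, Complex.I_im]
    ring
  have hnorm : ‖μ‖ ≤ 2 * r := by
    have h1 : |σ| = 1 := (pow_left_inj₀ (abs_nonneg σ) zero_le_one two_ne_zero).1
      (by rw [sq_abs, hσ, one_pow])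
    have h2 : ‖(1 : ℂ) + σ * Complex.I‖ ≤ 2 := by
      refine (norm_add_le _ _).trans ?_
      rw [norm_one, norm_mul, Complex.norm_I, Complex.norm_real, Real.norm_eq_abs, h1]
      norm_num
    rw [hμ, norm_mul, Complex.norm_real, Real.norm_eq_abs, abs_of_pos hr]
    nlinarith
  have hD : 1 / 2 ≤ ‖charFun μ‖ := half_le_norm_charFun hσ
  obtain ⟨R, hR, hRn⟩ := exists_isResolventAt (A := generator) (z := μ ^ 2) (by positivity)
    (exists_solution hre0 hμ2re hD)
    (eq_zero_of_generator_eq hre0 fun h => by rw [h, norm_zero] at hD; norm_num at hD)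
  rw [hμ2] at hR
  refine ⟨R, hR, hRn.trans ?_⟩
  rw [hre]
  set q : ℝ := (Real.sqrt (2 * r))⁻¹ with hq
  have hq0 : 0 < q := by positivity
  have hq2 : q ^ 2 * r = 1 / 2 := by
    rw [hq, inv_pow, Real.sq_sqrt (by positivity)]
    field_simp
  set t : ℝ := r⁻¹ with ht
  have ht0 : 0 < t := by positivity
  have htr : t * r = 1 := inv_mul_cancel₀ hr.ne'
  have hq2' : q ^ 2 = t / 2 := by
    have : q ^ 2 * (t * r) = t / 2 := by linear_combination t * hq2
    rwa [htr, mul_one] at this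
  have hq1 : q ≤ 1 + t / 2 := by nlinarith [sq_nonneg (q - 1)]
  have hqr : q * r ≤ 1 + r / 2 := by
    have : (q * r) ^ 2 = r / 2 := by linear_combination r * hq2
    nlinarith [sq_nonneg (q * r - 1)]
  have ht1 : t ≤ 1 + t ^ 2 := by nlinarith [sq_nonneg (t - 1)]
  have h1 : 1 ≤ r + t ^ 2 := by
    rcases le_total 1 r with h | h
    · nlinarith [sq_nonneg t]
    · have : 1 ≤ t := (one_le_inv₀ hr).2 h
      nlinarith
  calc (4 * q + 10 + 8 * ‖μ‖) * (2 + q) + t ^ 2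
      ≤ (4 * q + 10 + 8 * (2 * r)) * (2 + q) + t ^ 2 := by gcongr
    _ = 18 * q + 4 * q ^ 2 + 20 + 32 * r + 16 * (q * r) + t ^ 2 := by ring
    _ ≤ 200 * (r + t ^ 2) := by rw [hq2']; linarith

/-- Every nonzero imaginary number `i s` lies in the resolvent set, with a bound on the resolvent
that covers both frequency regimes. -/
theorem mem_resolventSet_and_norm_resolvent_le {s : ℝ} (hs : s ≠ 0) :
    (s : ℂ) * Complex.I ∈ resolventSet generator ∧
      ‖resolvent generator ((s : ℂ) * Complex.I)‖
        ≤ 200 * (|s| ^ (1 / 2 : ℝ) + 2 * |s|⁻¹) := by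
  have hs0 : 0 < |s| := abs_pos.2 hs
  set r : ℝ := Real.sqrt (|s| / 2) with hr
  have hr0 : 0 < r := Real.sqrt_pos.2 (by positivity)
  have hr2 : r ^ 2 = |s| / 2 := Real.sq_sqrt (by positivity)
  have hσ : (s / |s|) ^ 2 = 1 := by rw [div_pow, sq_abs, div_self (pow_ne_zero 2 hs)]
  have hsr : 2 * (s / |s|) * r ^ 2 = s := by
    rw [hr2]
    field_simp
  obtain ⟨R, hR, hRn⟩ := exists_resolvent_bound hr0 hσ
  rw [hsr] at hR
  have hmem : (s : ℂ) * Complex.I ∈ resolventSet generator := ⟨R, hR⟩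
  refine ⟨hmem, ?_⟩
  rw [(isResolventAt_resolvent hmem).unique hR]
  refine hRn.trans ?_
  have h1 : r ≤ |s| ^ (1 / 2 : ℝ) := by
    rw [← Real.sqrt_eq_rpow]
    exact Real.sqrt_le_sqrt (by linarith)
  have h2 : r⁻¹ ^ 2 = 2 * |s|⁻¹ := by
    rw [inv_pow, hr2, inv_div, div_eq_mul_inv]
  rw [h2]
  gcongr

end WaveHeat

end

theorem theorem3p1 :
    (∀ s : ℝ, s ≠ 0 →
      (s : ℂ) * Complex.I ∈ WaveHeat.resolventSet WaveHeat.generator) ∧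
    (fun s : ℝ => ‖WaveHeat.resolvent WaveHeat.generator ((s : ℂ) * Complex.I)‖)
      =O[Bornology.cobounded ℝ] (fun s : ℝ => |s| ^ (1 / 2 : ℝ)) ∧
    (fun s : ℝ => ‖WaveHeat.resolvent WaveHeat.generator ((s : ℂ) * Complex.I)‖)
      =O[𝓝[≠] (0 : ℝ)] (fun s : ℝ => |s|⁻¹) := by
  refine ⟨fun s hs => (WaveHeat.mem_resolventSet_and_norm_resolvent_le hs).1, ?_, ?_⟩
  · refine Asymptotics.IsBigO.of_bound 600 ?_
    have hev : ∀ᶠ s : ℝ in Bornology.cobounded ℝ, 1 ≤ ‖s‖ :=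
      tendsto_norm_cobounded_atTop.eventually_ge_atTop 1
    filter_upwards [hev] with s hs
    rw [Real.norm_eq_abs] at hs
    have hs0 : s ≠ 0 := abs_pos.1 (zero_lt_one.trans_le hs)
    rw [norm_norm, Real.norm_of_nonneg (by positivity)]
    refine (WaveHeat.mem_resolventSet_and_norm_resolvent_le hs0).2.trans ?_
    have h1 : 1 ≤ |s| ^ (1 / 2 : ℝ) := Real.one_le_rpow hs (by norm_num)
    have h2 : |s|⁻¹ ≤ 1 := inv_le_one_of_one_le₀ hs
    linarith
  · refine Asymptotics.IsBigO.of_bound 600 ?_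
    have hev : ∀ᶠ s : ℝ in 𝓝[≠] (0 : ℝ), s ∈ Ioo (-1 : ℝ) 1 :=
      eventually_nhdsWithin_of_eventually_nhds (Ioo_mem_nhds (by norm_num) (by norm_num))
    filter_upwards [hev, self_mem_nhdsWithin] with s hs hs0
    have hs0 : s ≠ 0 := hs0
    have hs1 : |s| ≤ 1 := (abs_lt.2 hs).le
    rw [norm_norm, Real.norm_of_nonneg (by positivity)]
    refine (WaveHeat.mem_resolventSet_and_norm_resolvent_le hs0).2.trans ?_
    have h1 : |s| ^ (1 / 2 : ℝ) ≤ 1 := Real.rpow_le_one (abs_nonneg _) hs1 (by norm_num)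
    have h2 : 1 ≤ |s|⁻¹ := (one_le_inv₀ (abs_pos.2 hs0)).2 hs1
    linarith
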